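/- For each $m\ge 1$ let $n=n(m)\ge 2$ and let $X_{i,j}$, $1\le i\le m$, $1\le j\le n$, be independent with $X_{i,j}\sim N(\mu_i,\sigma^2)$, where $\sigma^2>0$ is fixed and unknown and the means $\mu_i$ are arbitrary (and may depend on $m$). Consider the hypotheses $H_i:\mu_i=0$, $i=1,\dots,m$. Put $S_{n,i}=\sum_{j=1}^n X_{i,j}^2$, $\overline X_{n,i}=\frac1n\sum_{j=1}^n X_{i,j}$, $\hat\sigma_{n,i}^2=\frac1{n-1}\sum_{j=1}^n (X_{i,j}-\overline X_{n,i})^2$ and $T_{n,i}=\sqrt n\,\overline X_{n,i}/\hat\sigma_{n,i}$. Let $\hat\sigma^2$ be an estimator with $$\hat\sigma^2-\sigma^2=O_P\!\left(\frac1{\sqrt{mn}}\right)\qquad (m\to\infty).$$ Fix $\alpha\in(0,1)$ and $\gamma\in(0,1]$, and let $u=\chi^2_n(1-m^{\gamma-1})$ be the $(1-m^{\gamma-1})$-quantile of the chi-squared distribution with $n$ degrees of freedom ($u=0$ if $\gamma=1$). The modified two-stage procedure selects $\hat I_n(u)=\{i: S_{n,i}>\hat\sigma^2u\}$ and rejects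 $H_i$ for those $i\in\hat I_n(u)$ for which $|T_{n,i}|$ exceeds the $1-\alpha/(2|\hat I_n(u)|)$ quantile of the $t$-distribution with $n-1$ degrees of freedom. Its familywise error rate $\mathrm{FWER}_m$ is the probability that at least one $H_i$ with $\mu_i=0$ is rejected; the procedure asymptotically controls the FWER if $\limsup_{m\to\infty}\mathrm{FWER}_m\le\alpha$. Assume that $\lim_{m\to\infty}(\log m)/n=d$ with $0\le d<\infty$. Then: (i) if $\gamma>1/2$, the modified two-stage procedure asymptotically controls the FWER; (ii) if $\gamma=1/2$ and $d>0$, it asymptotically controls the FWER. More generally, for $d>0$ the same is true whenever $$\gamma>\frac12\left[1-\frac{\epsilon^*}{d}+\frac{\log(1+\epsilon^*)}{d}\right],\qquad \epsilon^*=2(1-\gamma)d+c^*\sqrt{(1-\gamma)d}.$$ Here, for $\gamma<1$, $c^*=c^*(\gamma,d)$ is the solution $c\in(0,2)$ of $a(c)=(1-\gamma)d$, where $a(c)=\left[g^{-1}(2/c^2)/c\right]^2$ and $g^{-1}$ is the inverse of the function $g(x)=(e^x-1-x)/x^2$ on $(0,\infty)$; for $\gamma=1$, $\epsilon^*=0$.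 -/

import Mathlib

open MeasureTheory ProbabilityTheory Filter Topology
open scoped NNReal ENNReal

noncomputable section

namespace TwoStage

/-! ### Sample statistics -/

/-- The sum of squares `S = ∑ⱼ xⱼ²` of a sample. -/
def sumSq {n : ℕ} (x : Fin n → ℝ) : ℝ := ∑ j, x j ^ 2

/-- The sample mean. -/
def sampleMean {n : ℕ} (x : Fin n → ℝ) : ℝ := (∑ j, x j) / n

/-- The unbiased sample variance (for sample size `n ≥ 2`). -/
def sampleVar {n : ℕ} (x : Fin n → ℝ) : ℝ :=
  (∑ j, (x j - sampleMean x) ^ 2) / ((n : ℝ) - 1)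

/-- The one-sample `t`-statistic `√n x̄ / s`. -/
def tStat {n : ℕ} (x : Fin n → ℝ) : ℝ :=
  √(n : ℝ) * sampleMean x / √(sampleVar x)

/-! ### Chi-squared and Student distributions, quantiles -/

/-- The chi-squared distribution with `n` degrees of freedom: the law of the sum of squares of
`n` independent standard normal variables. -/
def chiSq (n : ℕ) : Measure ℝ :=
  (Measure.pi fun _ : Fin n => gaussianReal 0 1).map sumSq

/-- Student's `t`-distribution with `ν` degrees of freedom: the law of `Z / √(V / ν)` with `Z`
standard normal, `V` chi-squared with `ν` degrees of freedom, `Z` and `V` independent. -/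
def studentT (ν : ℕ) : Measure ℝ :=
  ((gaussianReal 0 1).prod (chiSq ν)).map fun z => z.1 / √(z.2 / ν)

/-- The `p`-quantile `inf {x : μ (-∞, x] ≥ p}` of a probability distribution on `ℝ`, for
`0 < p < 1`. (For `p = 0` the infimum is over all of `ℝ` and takes the value `0`, which for the
chi-squared distribution is the left end point of its support.) -/
def quantile (μ : Measure ℝ) (p : ℝ) : ℝ := sInf {x : ℝ | p ≤ μ.real (Set.Iic x)}

/-! ### The two-stage procedure with estimated variance -/

/-- The first-stage critical value `u = χ²ₙ(1 - β)` with `β = m ^ (γ - 1)`. -/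
def selThreshold (m n : ℕ) (γ : ℝ) : ℝ := quantile (chiSq n) (1 - (m : ℝ) ^ (γ - 1))

/-- The hypotheses selected in the first stage from the data `x` (`m` samples of size `n`) with
variance estimate `s2`: those with `Sᵢ > s2 * u`. -/
def selected {m n : ℕ} (γ s2 : ℝ) (x : Fin m → Fin n → ℝ) : Finset (Fin m) :=
  {i | s2 * selThreshold m n γ < sumSq (x i)}

/-- The hypotheses rejected by the two-stage procedure: those selected in the first stage for
which `|Tᵢ|` exceeds the `1 - α / (2 k)` quantile of the `t`-distribution with `n - 1` degrees of
freedom, `k` being the number of selected hypotheses. -/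
def rejected {m n : ℕ} (α γ s2 : ℝ) (x : Fin m → Fin n → ℝ) : Finset (Fin m) :=
  {i ∈ selected γ s2 x |
    quantile (studentT (n - 1)) (1 - α / (2 * ((selected γ s2 x).card : ℝ))) < |tStat (x i)|}

/-- The familywise error rate of the procedure, when the data are `X`, the variance estimator is
`σ2hat`, and `mean i` is the true mean of the `i`-th population: the probability that
at least one true null hypothesis (`mean i = 0`) is rejected. -/
def fwer {Ω : Type*} [MeasurableSpace Ω] (P : Measure Ω) {m n : ℕ} (α γ : ℝ)
    (mean : Fin m → ℝ) (X : Fin m → Fin n → Ω → ℝ) (σ2hat : Ω → ℝ) : ℝ≥0∞ :=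
  P {ω | ∃ i, mean i = 0 ∧ i ∈ rejected α γ (σ2hat ω) fun i j => X i j ω}

/-- `Y m = O_P(r m)` as `m → ∞`. -/
def IsBigOP {Ω : ℕ → Type*} [∀ m, MeasurableSpace (Ω m)] (P : ∀ m, Measure (Ω m))
    (Y : ∀ m, Ω m → ℝ) (r : ℕ → ℝ) : Prop :=
  ∀ ε : ℝ, 0 < ε → ∃ C : ℝ, ∀ᶠ m in atTop, P m {ω | C * r m < |Y m ω|} ≤ ENNReal.ofReal ε

/-! ### The constants `c*` and `ε*` -/

/-- `g x = (eˣ - 1 - x) / x²`, an increasing bijection from `(0, ∞)` onto `(1/2, ∞)`. -/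
def g (x : ℝ) : ℝ := (Real.exp x - 1 - x) / x ^ 2

/-- The inverse of `g` on `(0, ∞)`; meaningful on `(1/2, ∞)`. -/
def gInv : ℝ → ℝ := Function.invFunOn g (Set.Ioi 0)

/-- `a c = (g⁻¹(2 / c²) / c)²`; meaningful for `0 < c < 2`, that is, `2 / c² > 1/2`. -/
def a (c : ℝ) : ℝ := (gInv (2 / c ^ 2) / c) ^ 2

/-- `c*(γ, d)`: the solution `c ∈ (0, 2)` of `a c = (1 - γ) d`, where `γ < 1` and `d > 0`. -/
def cStar (γ d : ℝ) : ℝ := Function.invFunOn a (Set.Ioo 0 2) ((1 - γ) * d)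

/-- `ε* = 2 (1 - γ) d + c* √((1 - γ) d)`; for `γ = 1` this is `0`. -/
def epsStar (γ d : ℝ) : ℝ := 2 * (1 - γ) * d + cStar γ d * √((1 - γ) * d)

end TwoStage

end

/-! Suppose first that σ² is known. For a true null, the sum of squares is independent of the
scale-invariant statistic T (`stdNormal_inter_sumSq`), so selection does not bias the t-test. Let q
be the selection probability of a null, and let M_i count the other selected nulls, independently of
sample i. The rejection probability of i is then at most Σ_k P(M_i = k) q α/(k+1). Summed over i,
this is α times the probability that some null is selected, because {N = k+1} is counted once for
each of its k+1 selected nulls.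

When |σ̂² - σ²| ≤ σ²δ, the random selection lies between those at the fixed thresholds (1 ± δ)u,
however σ̂² depends on the data. Counting only nulls above (1+δ)u lowers the critical value, which
is the safe direction. Nulls in the shell between the thresholds add at most 2ρα, where ρ is the
shell mass relative to the upper tail (`measure_exists_mem_region_le`, `fwer_le`).

It remains to see ρ → 0. A change of variance in the Gaussian law, a tangent-line bound and a
second-moment estimate (`stdNormal_tail_dilate`) control how the chi-squared tail changes under
dilation. With δ of order 1/√(mn) and tail at least m^(γ-1), the relative change is O(m^(-γ/2)) up
to a factor tending to 1. This vanishes for every γ > 0, and all three claims follow from this one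
limit. -/

/-! ### Random number of selections: the counting bound. -/

/-- **Leave-one-out bound.** Independent `X i` are compared with nested sets `C ⊆ B`, and the
level of the rejection region `R k` depends on the number `k` of indices with `X i ∈ C`. -/
theorem measure_exists_mem_region_le {Ω ι E : Type*} [MeasurableSpace Ω] {P : Measure Ω}
    [IsProbabilityMeasure P] [DecidableEq ι] [MeasurableSpace E] {X : ι → Ω → E}
    (hX : ∀ i, Measurable (X i)) (hind : iIndepFun X P) (J : Finset ι) {B C : Set E}
    [DecidablePred (· ∈ C)]
    (hB : MeasurableSet B) (hC : MeasurableSet C) {R : ℕ → Set E}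
    (hR : ∀ k, MeasurableSet (R k)) {q a ρ : ℝ≥0∞} (hq : ∀ i ∈ J, P (X i ⁻¹' C) = q)
    (hCR : ∀ i ∈ J, ∀ k : ℕ, 1 ≤ k → P (X i ⁻¹' (C ∩ R k)) ≤ q * (a / k))
    (hBR : ∀ i ∈ J, ∀ k : ℕ, 1 ≤ k → P (X i ⁻¹' ((B \ C) ∩ R k)) ≤ ρ * q * (a / k)) :
    P {ω | ∃ i ∈ J, X i ω ∈ B ∧ X i ω ∈ R (max 1 (J.filter fun j => X j ω ∈ C).card)}
      ≤ a * (1 + 2 * ρ) := by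
  set N : Ω → ℕ := fun ω => (J.filter fun j => X j ω ∈ C).card with hN
  -- Leaving out i makes the count independent of `X i`; `N` exceeds it by one exactly when `X i`
  -- lies in `C`.
  set M : ι → Ω → ℕ := fun i ω => ((J.erase i).filter fun j => X j ω ∈ C).card with hM
  have hcount : ∀ K : Finset ι, Measurable fun ω => (K.filter fun j => X j ω ∈ C).card := by
    intro K
    simp only [Finset.card_filter]
    exact Finset.measurable_sum _ fun j _ =>
      Measurable.ite (hX j hC) measurable_const measurable_const
  have hindM : ∀ i (k : ℕ) (D : Set E), MeasurableSet D →
      P (M i ⁻¹' {k} ∩ X i ⁻¹' D) = P (M i ⁻¹' {k}) * P (X i ⁻¹' D) := by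
    intro i k D hD
    have h0 := hind.indepFun_finset (J.erase i) {i} (by simp) hX
    have hf : Measurable fun x : (J.erase i) → E =>
        ((Finset.univ : Finset (J.erase i)).filter fun j => x j ∈ C).card := by
      simp only [Finset.card_filter]
      exact Finset.measurable_sum _ fun j _ =>
        Measurable.ite (measurable_pi_apply j hC) measurable_const measurable_const
    have h1 := (h0.comp hf
      (measurable_pi_apply (⟨i, by simp⟩ : ({i} : Finset ι)))).measure_inter_preimage_eq_mul
      {k} D (measurableSet_singleton k) hD
    have hMe : M i = (fun x : (J.erase i) → E =>
        ((Finset.univ : Finset (J.erase i)).filter fun j => x j ∈ C).card) ∘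
          fun ω (j : (J.erase i)) => X j ω := by
      funext ω
      simp only [hM, Function.comp, Finset.card_filter]
      exact (Finset.sum_coe_sort (J.erase i) (fun j => if X j ω ∈ C then 1 else 0)).symm
    rw [hMe]
    exact h1
  have hMN : ∀ i ∈ J, ∀ ω, N ω = M i ω + if X i ω ∈ C then 1 else 0 := by
    intro i hi ω
    simp only [hN, hM, Finset.card_filter]
    rw [← Finset.sum_erase_add J _ hi]
  have hMle : ∀ i ω, M i ω < J.card + 1 := fun i ω =>
    Nat.lt_succ_of_le ((Finset.card_filter_le _ _).trans (Finset.card_erase_le))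
  have hsub : {ω | ∃ i ∈ J, X i ω ∈ B ∧ X i ω ∈ R (max 1 (N ω))} ⊆
      ⋃ i ∈ J, ⋃ k ∈ Finset.range (J.card + 1), ((M i ⁻¹' {k} ∩ X i ⁻¹' (C ∩ R (k + 1))) ∪
        (M i ⁻¹' {k} ∩ X i ⁻¹' ((B \ C) ∩ R (max 1 k)))) := by
    rintro ω ⟨i, hi, hiB, hiR⟩
    simp only [Set.mem_iUnion]
    refine ⟨i, hi, M i ω, Finset.mem_range.2 (hMle i ω), ?_⟩
    have h := hMN i hi ω
    by_cases hc : X i ω ∈ C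
    · left
      rw [if_pos hc] at h
      refine ⟨rfl, hc, ?_⟩
      rw [h] at hiR
      simpa using hiR
    · right
      rw [if_neg hc, add_zero] at h
      rw [h] at hiR
      exact ⟨rfl, ⟨hiB, hc⟩, hiR⟩
  have hterm : ∀ i ∈ J, ∀ k : ℕ, P ((M i ⁻¹' {k} ∩ X i ⁻¹' (C ∩ R (k + 1))) ∪
        (M i ⁻¹' {k} ∩ X i ⁻¹' ((B \ C) ∩ R (max 1 k)))) ≤
      a * (1 + 2 * ρ) * (P (M i ⁻¹' {k} ∩ X i ⁻¹' C) / (k + 1 : ℕ)) := by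
    intro i hi k
    refine (measure_union_le _ _).trans ?_
    rw [hindM i k _ (hC.inter (hR _)), hindM i k _ ((hB.diff hC).inter (hR _)), hindM i k _ hC,
      hq i hi]
    -- Off `C` the count is k rather than k + 1. Since k + 1 ≤ 2 max(1, k), this costs the factor 2
    -- in front of `ρ`.
    have hk : ((max 1 k : ℕ) : ℝ≥0∞)⁻¹ ≤ 2 * ((k + 1 : ℕ) : ℝ≥0∞)⁻¹ := by
      have h2 : ((max 1 k : ℕ) : ℝ≥0∞)⁻¹ = 2 * (2 * ((max 1 k : ℕ) : ℝ≥0∞))⁻¹ := by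
        rw [ENNReal.mul_inv (by simp) (by simp), ← mul_assoc,
          ENNReal.mul_inv_cancel (by simp) (by simp), one_mul]
      rw [h2]
      gcongr
      exact_mod_cast (by omega : k + 1 ≤ 2 * max 1 k)
    calc _ ≤ P (M i ⁻¹' {k}) * (q * (a / (k + 1 : ℕ)))
          + P (M i ⁻¹' {k}) * (ρ * q * (a / (max 1 k : ℕ))) := by
          gcongr
          · exact hCR i hi (k + 1) (by omega)
          · exact hBR i hi _ (le_max_left _ _)
      _ ≤ P (M i ⁻¹' {k}) * (q * (a / (k + 1 : ℕ)))
          + P (M i ⁻¹' {k}) * (ρ * q * (a * (2 * ((k + 1 : ℕ) : ℝ≥0∞)⁻¹))) := by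
          rw [div_eq_mul_inv a ((max 1 k : ℕ) : ℝ≥0∞)]
          gcongr
      _ = _ := by
          simp only [div_eq_mul_inv]
          ring
  -- On {N = k+1} exactly k + 1 of the events {X i ∈ C} occur, so the sum of their indicators is
  -- constant there.
  have hsum : ∀ k : ℕ, ∑ i ∈ J, P (M i ⁻¹' {k} ∩ X i ⁻¹' C) = (k + 1 : ℕ) * P (N ⁻¹' {k + 1}) := by
    intro k
    have hA : MeasurableSet (N ⁻¹' {k + 1}) := hcount J (measurableSet_singleton _)
    have h1 : ∀ i ∈ J, P (M i ⁻¹' {k} ∩ X i ⁻¹' C) =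
        ∫⁻ ω in N ⁻¹' {k + 1}, (X i ⁻¹' C).indicator 1 ω ∂P := by
      intro i hi
      rw [lintegral_indicator_one (hX i hC), Measure.restrict_apply (hX i hC)]
      congr 1
      ext ω
      have h := hMN i hi ω
      by_cases hc : X i ω ∈ C
      · simp only [hc, if_true] at h
        simp [hc, h]
      · simp [hc]
    rw [Finset.sum_congr rfl h1, ← lintegral_finsetSum _ fun i _ =>
      (measurable_const.indicator (hX i hC) : Measurable ((X i ⁻¹' C).indicator 1))]
    rw [setLIntegral_congr_fun hA (g := fun _ => ((k + 1 : ℕ) : ℝ≥0∞)), setLIntegral_const]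
    intro ω hω
    have : N ω = k + 1 := hω
    simp only [Set.indicator, Set.mem_preimage, Pi.one_apply]
    rw [← this]
    simp only [hN, Finset.card_filter]
    push_cast
    rfl
  have htot : ∑ i ∈ J, ∑ k ∈ Finset.range (J.card + 1),
      P (M i ⁻¹' {k} ∩ X i ⁻¹' C) / (k + 1 : ℕ) ≤ 1 := by
    rw [Finset.sum_comm]
    have : ∀ k ∈ Finset.range (J.card + 1), ∑ i ∈ J, P (M i ⁻¹' {k} ∩ X i ⁻¹' C) / (k + 1 : ℕ)
        = P (N ⁻¹' {k + 1}) := by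
      intro k _
      simp only [div_eq_mul_inv]
      rw [← Finset.sum_mul, hsum, mul_comm, ← mul_assoc,
        ENNReal.inv_mul_cancel (by simp) (ENNReal.natCast_ne_top _), one_mul]
    rw [Finset.sum_congr rfl this, ← measure_biUnion_finset]
    · exact prob_le_one
    · intro k _ l _ hkl
      exact Disjoint.preimage _ (by simpa using hkl)
    · exact fun k _ => hcount J (measurableSet_singleton _)
  calc _ ≤ _ := measure_mono hsub
    _ ≤ ∑ i ∈ J, ∑ k ∈ Finset.range (J.card + 1), P ((M i ⁻¹' {k} ∩ X i ⁻¹' (C ∩ R (k + 1))) ∪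
        (M i ⁻¹' {k} ∩ X i ⁻¹' ((B \ C) ∩ R (max 1 k)))) :=
      (measure_biUnion_finset_le _ _).trans
        (Finset.sum_le_sum fun i _ => measure_biUnion_finset_le _ _)
    _ ≤ ∑ i ∈ J, ∑ k ∈ Finset.range (J.card + 1),
        a * (1 + 2 * ρ) * (P (M i ⁻¹' {k} ∩ X i ⁻¹' C) / (k + 1 : ℕ)) :=
      Finset.sum_le_sum fun i hi => Finset.sum_le_sum fun k _ => hterm i hi k
    _ ≤ a * (1 + 2 * ρ) := by
      simp only [← Finset.mul_sum]
      exact mul_le_of_le_one_right' htot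

/-! ### Gaussian scaling, and independence of the squared norm from scale-invariant events. -/

/-- A finite product of measures with densities has the product of the densities as density. -/
theorem pi_withDensity_eq {ι : Type*} [Fintype ι] {E : ι → Type*} [∀ i, MeasurableSpace (E i)]
    (μ : ∀ i, Measure (E i)) [∀ i, IsProbabilityMeasure (μ i)] {w : ∀ i, E i → ℝ≥0∞}
    (hw : ∀ i, Measurable (w i)) [∀ i, SigmaFinite ((μ i).withDensity (w i))] :
    Measure.pi (fun i => (μ i).withDensity (w i)) =
      (Measure.pi μ).withDensity fun x => ∏ i, w i (x i) := by
  refine Measure.pi_eq fun s hs => ?_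
  have hm : ∀ i, Measurable ((s i).indicator (w i)) := fun i => (hw i).indicator (hs i)
  rw [withDensity_apply _ (MeasurableSet.univ_pi hs), ← lintegral_indicator (MeasurableSet.univ_pi hs)]
  have h1 : (Set.univ.pi s).indicator (fun x => ∏ i, w i (x i)) =
      fun x => ∏ i, (s i).indicator (w i) (x i) := by
    funext x
    by_cases hx : x ∈ Set.univ.pi s
    · rw [Set.indicator_of_mem hx]
      exact Finset.prod_congr rfl fun i _ => (Set.indicator_of_mem (hx i trivial) _).symm
    · rw [Set.indicator_of_notMem hx]
      simp only [Set.mem_pi, Set.mem_univ, true_implies, not_forall] at hx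
      obtain ⟨i, hi⟩ := hx
      exact (Finset.prod_eq_zero (Finset.mem_univ i) (Set.indicator_of_notMem hi _)).symm
  rw [h1, lintegral_prod_eq_prod_lintegral_of_indepFun Finset.univ
    (fun i (x : ∀ i, E i) => (s i).indicator (w i) (x i))
    (iIndepFun_pi fun i => (hm i).aemeasurable) fun i => (hm i).comp (measurable_pi_apply i)]
  refine Finset.prod_congr rfl fun i _ => ?_
  rw [withDensity_apply _ (hs i), ← lintegral_indicator (hs i),
    ← (measurePreserving_eval μ i).lintegral_comp (hm i)]

namespace TwoStage

/-- The standard Gaussian distribution on `Fin n → ℝ`. -/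
noncomputable def stdNormal (n : ℕ) : Measure (Fin n → ℝ) := Measure.pi fun _ => gaussianReal 0 1

instance (n : ℕ) : IsProbabilityMeasure (stdNormal n) := by
  unfold stdNormal; infer_instance

@[fun_prop]
theorem measurable_sumSq {n : ℕ} : Measurable (sumSq (n := n)) := by
  unfold sumSq; fun_prop

theorem sumSq_nonneg {n : ℕ} (x : Fin n → ℝ) : 0 ≤ sumSq x :=
  Finset.sum_nonneg fun _ _ => sq_nonneg _

theorem sumSq_const_mul {n : ℕ} (c : ℝ) (x : Fin n → ℝ) :
    sumSq (fun i => c * x i) = c ^ 2 * sumSq x := by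
  simp only [sumSq, mul_pow, Finset.mul_sum]

theorem gaussianReal_withDensity_exp {c : ℝ} (hc : 0 < c) :
    (gaussianReal 0 1).withDensity (fun x => ENNReal.ofReal (c * Real.exp (-((c ^ 2 - 1) / 2 * x ^ 2))))
      = gaussianReal 0 (NNReal.mk ((c⁻¹) ^ 2) (sq_nonneg _)) := by
  have hv : (NNReal.mk ((c⁻¹) ^ 2) (sq_nonneg _)) ≠ 0 := by
    intro h
    have := congrArg NNReal.toReal h
    simp at this
    exact hc.ne' this
  rw [gaussianReal_of_var_ne_zero _ one_ne_zero, gaussianReal_of_var_ne_zero _ hv,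
    ← withDensity_mul _ (measurable_gaussianPDF 0 1) (by fun_prop)]
  congr 1
  funext x
  simp only [Pi.mul_apply, gaussianPDF]
  rw [← ENNReal.ofReal_mul (gaussianPDFReal_nonneg _ _ _)]
  congr 1
  simp only [gaussianPDFReal, NNReal.coe_one, sub_zero, mul_one, NNReal.coe_mk]
  rw [Real.sqrt_mul' _ (sq_nonneg _), Real.sqrt_sq (inv_pos.2 hc).le, mul_inv, inv_inv]
  have : Real.exp (-x ^ 2 / (2 * c⁻¹ ^ 2)) =
      Real.exp (-x ^ 2 / 2) * Real.exp (-((c ^ 2 - 1) / 2 * x ^ 2)) := by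
    rw [← Real.exp_add]
    congr 1
    field_simp
    ring
  rw [this]
  ring

/-- Change of variance for the standard Gaussian distribution. -/
theorem stdNormal_apply_eq {n : ℕ} {c : ℝ} (hc : 0 < c) {A : Set (Fin n → ℝ)}
    (hA : MeasurableSet A) :
    stdNormal n A = ENNReal.ofReal (c ^ n) * ∫⁻ x in {x | (fun i => c * x i) ∈ A},
      ENNReal.ofReal (Real.exp (-((c ^ 2 - 1) / 2 * sumSq x))) ∂stdNormal n := by
  have hw : Measurable fun x : ℝ =>
    ENNReal.ofReal (c * Real.exp (-((c ^ 2 - 1) / 2 * x ^ 2))) := by fun_prop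
  have hprob : IsProbabilityMeasure ((gaussianReal 0 1).withDensity
      fun x => ENNReal.ofReal (c * Real.exp (-((c ^ 2 - 1) / 2 * x ^ 2)))) := by
    rw [gaussianReal_withDensity_exp hc]; infer_instance
  have h1 : stdNormal n = ((stdNormal n).withDensity fun x => ∏ i, ENNReal.ofReal
      (c * Real.exp (-((c ^ 2 - 1) / 2 * x i ^ 2)))).map fun x i => c * x i := by
    have hg : gaussianReal 0 1 = ((gaussianReal 0 1).withDensity
      fun x => ENNReal.ofReal (c * Real.exp (-((c ^ 2 - 1) / 2 * x ^ 2)))).map (c * ·) := by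
      rw [gaussianReal_withDensity_exp hc, gaussianReal_map_const_mul, mul_zero]
      congr 1
      ext
      simp [hc.ne']
    have hm : IsProbabilityMeasure (((gaussianReal 0 1).withDensity
      fun x => ENNReal.ofReal (c * Real.exp (-((c ^ 2 - 1) / 2 * x ^ 2)))).map (c * ·)) := by
      rw [← hg]; infer_instance
    unfold stdNormal
    rw [← pi_withDensity_eq _ fun _ => hw, Measure.pi_map_pi fun _ => by fun_prop]
    congr 1
    funext i
    exact hg
  have hmeas : Measurable fun (x : Fin n → ℝ) (i : Fin n) => c * x i := by fun_prop
  conv_lhs => rw [h1]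
  rw [Measure.map_apply hmeas hA, withDensity_apply _ (hmeas hA),
    ← lintegral_const_mul' _ _ ENNReal.ofReal_ne_top]
  refine lintegral_congr fun x => ?_
  rw [← ENNReal.ofReal_prod_of_nonneg fun i _ => by positivity, ← ENNReal.ofReal_mul (by positivity)]
  congr 1
  rw [Finset.prod_mul_distrib, ← Real.exp_sum]
  simp [sumSq, Finset.mul_sum]

/-- Dilation by c = √(1 - 2t) produces the weight exp(t S), as (1 - c²)/2 = t, and fixes `A`. The
moment generating function of S on `A` is thus P(A) times the one on the whole space. -/
theorem lintegral_exp_sumSq_of_lt {n : ℕ} {A : Set (Fin n → ℝ)} (hA : MeasurableSet A)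
    (hinv : ∀ c : ℝ, 0 < c → ∀ x : Fin n → ℝ, (fun i => c * x i) ∈ A ↔ x ∈ A) {t : ℝ}
    (ht : t < 1 / 2) :
    ENNReal.ofReal (√(1 - 2 * t) ^ n) *
      ∫⁻ x in A, ENNReal.ofReal (Real.exp (t * sumSq x)) ∂stdNormal n = stdNormal n A := by
  have hc : 0 < √(1 - 2 * t) := Real.sqrt_pos.2 (by linarith)
  rw [stdNormal_apply_eq hc hA]
  simp only [hinv _ hc, Set.ofPred_mem_eq, Real.sq_sqrt (by linarith : 0 ≤ 1 - 2 * t)]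
  congr 1
  refine lintegral_congr fun x => ?_
  congr 2
  ring

/-- If the integral were finite, it would bound the integrals at all s < 1/2, and the identity there
would force P(A) ≤ (1 - 2s)^(n/2) · const → 0 as s ↑ 1/2. This makes the moment generating functions
agree on all of ℝ. -/
theorem lintegral_exp_sumSq_of_ge {n : ℕ} (hn : n ≠ 0) {A : Set (Fin n → ℝ)} (hA : MeasurableSet A)
    (hinv : ∀ c : ℝ, 0 < c → ∀ x : Fin n → ℝ, (fun i => c * x i) ∈ A ↔ x ∈ A) {t : ℝ}
    (ht : 1 / 2 ≤ t) (hA0 : stdNormal n A ≠ 0) :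
    ∫⁻ x in A, ENNReal.ofReal (Real.exp (t * sumSq x)) ∂stdNormal n = ∞ := by
  by_contra hfin
  refine hA0 (le_antisymm ?_ zero_le)
  have hlim : Tendsto (fun s : ℝ => ENNReal.ofReal (√(1 - 2 * s) ^ n) *
      ∫⁻ x in A, ENNReal.ofReal (Real.exp (t * sumSq x)) ∂stdNormal n) (𝓝[<] (1 / 2))
      (𝓝 0) := by
    have h1 : Tendsto (fun s : ℝ => ENNReal.ofReal (√(1 - 2 * s) ^ n)) (𝓝 (1 / 2)) (𝓝 0) := by
      have h2 : Continuous fun s : ℝ => ENNReal.ofReal (√(1 - 2 * s) ^ n) :=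
        ENNReal.continuous_ofReal.comp (by fun_prop)
      simpa [hn] using h2.tendsto (1 / 2)
    simpa using ENNReal.Tendsto.mul_const (h1.mono_left nhdsWithin_le_nhds) (Or.inr hfin)
  refine ge_of_tendsto hlim ?_
  filter_upwards [self_mem_nhdsWithin] with s hs
  rw [← lintegral_exp_sumSq_of_lt hA hinv hs]
  gcongr with x
  · exact sumSq_nonneg x
  · exact (le_of_lt hs).trans ht

/-- Under the standard Gaussian distribution, the squared norm is independent of every event that
is invariant under positive scaling. -/
theorem stdNormal_inter_sumSq {n : ℕ} (hn : n ≠ 0) {A : Set (Fin n → ℝ)} (hA : MeasurableSet A)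
    (hinv : ∀ c : ℝ, 0 < c → ∀ x : Fin n → ℝ, (fun i => c * x i) ∈ A ↔ x ∈ A) {D : Set ℝ}
    (hD : MeasurableSet D) :
    stdNormal n (sumSq ⁻¹' D ∩ A) = stdNormal n (sumSq ⁻¹' D) * stdNormal n A := by
  by_cases hA0 : stdNormal n A = 0
  · rw [hA0, mul_zero]
    exact measure_mono_null Set.inter_subset_right hA0
  have hAtop : stdNormal n A ≠ ∞ := measure_ne_top _ _
  have huniv : ∀ c : ℝ, 0 < c → ∀ x : Fin n → ℝ,
      (fun i => c * x i) ∈ (Set.univ : Set (Fin n → ℝ)) ↔ x ∈ (Set.univ : Set (Fin n → ℝ)) := by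
    simp
  -- Independence says that `sumSq` has the same law under the restriction to `A` as under P(A) · P.
  set μ' : Measure (Fin n → ℝ) := (stdNormal n A) • stdNormal n with hμ'
  have : IsFiniteMeasure μ' := Measure.smul_finite _ hAtop
  have hlint : ∀ t : ℝ, ∫⁻ x in A, ENNReal.ofReal (Real.exp (t * sumSq x)) ∂stdNormal n =
      ∫⁻ x, ENNReal.ofReal (Real.exp (t * sumSq x)) ∂μ' := by
    intro t
    rw [hμ', lintegral_smul_measure, smul_eq_mul]
    rcases lt_or_ge t (1 / 2) with ht | ht
    · have hc : 0 < √(1 - 2 * t) ^ n := pow_pos (Real.sqrt_pos.2 (by linarith)) _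
      have h1 := lintegral_exp_sumSq_of_lt hA hinv ht
      have h2 := lintegral_exp_sumSq_of_lt MeasurableSet.univ huniv ht
      rw [measure_univ, setLIntegral_univ] at h2
      refine (ENNReal.mul_right_inj (ENNReal.ofReal_pos.2 hc).ne' ENNReal.ofReal_ne_top).1 ?_
      rw [h1, mul_left_comm, h2, mul_one]
    · rw [lintegral_exp_sumSq_of_ge hn hA hinv ht hA0]
      have h2 := lintegral_exp_sumSq_of_ge hn MeasurableSet.univ huniv ht (by simp)
      rw [setLIntegral_univ] at h2
      rw [h2, ENNReal.mul_top hA0]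
  have hmgf : mgf sumSq ((stdNormal n).restrict A) = mgf sumSq μ' := by
    funext t
    simp only [mgf]
    rw [integral_eq_lintegral_of_nonneg_ae (ae_of_all _ fun x => (Real.exp_pos _).le)
      (by fun_prop), integral_eq_lintegral_of_nonneg_ae (ae_of_all _ fun x => (Real.exp_pos _).le)
      (by fun_prop), hlint]
  -- Finiteness near 0 lets the equality extend analytically to the imaginary axis, where it equates
  -- characteristic functions.
  have h0 : (0 : ℝ) ∈ interior (integrableExpSet sumSq ((stdNormal n).restrict A)) := by
    refine mem_interior.2 ⟨Set.Iio (1 / 2), fun t ht => ?_, isOpen_Iio, by simp⟩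
    refine ⟨by fun_prop, ?_⟩
    rw [hasFiniteIntegral_iff_ofReal (ae_of_all _ fun x => (Real.exp_pos _).le)]
    have hc : 0 < √(1 - 2 * t) ^ n := pow_pos (Real.sqrt_pos.2 (by
      have := Set.mem_Iio.1 ht; linarith)) _
    refine lt_top_iff_ne_top.2 fun h => hAtop ?_
    rw [← lintegral_exp_sumSq_of_lt hA hinv ht, h, ENNReal.mul_top (ENNReal.ofReal_pos.2 hc).ne']
  have heq := eqOn_complexMGF_of_mgf' hmgf (by simp [hμ', hA0, IsProbabilityMeasure.ne_zero])
  have hmap : ((stdNormal n).restrict A).map sumSq = μ'.map sumSq := by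
    refine Measure.ext_of_charFun ?_
    funext t
    rw [← complexMGF_mul_I (by fun_prop), ← complexMGF_mul_I (by fun_prop)]
    exact heq (by simpa using h0)
  have h := congrArg (fun μ : Measure ℝ => μ D) hmap
  simp only [Measure.map_apply measurable_sumSq hD] at h
  rwa [Measure.restrict_apply (measurable_sumSq hD), hμ', Measure.smul_apply, smul_eq_mul,
    mul_comm] at h

/-! ### Upper tails of the chi-squared distribution -/

theorem memLp_sq_gaussianReal : MemLp (fun x : ℝ => x ^ 2) 2 (gaussianReal 0 1) := by
  have h := memLp_id_gaussianReal' (μ := 0) (v := 1) 4 (by simp)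
  have h2 := h.norm_rpow_div 2
  have h42 : (4 : ℝ≥0∞) / 2 = 2 := by
    rw [show (4 : ℝ≥0∞) = 2 * 2 by norm_num]
    exact ENNReal.mul_div_cancel_right (by simp) (by simp)
  simpa [h42] using h2

theorem integral_sumSq (n : ℕ) : ∫ x, sumSq x ∂stdNormal n = n := by
  have h1 : ∫ x : ℝ, x ^ 2 ∂gaussianReal 0 1 = 1 := by
    have := variance_fun_id_gaussianReal (μ := 0) (v := 1)
    rw [variance_eq_integral (by fun_prop)] at this
    simpa [integral_id_gaussianReal] using this
  have hi : Integrable (fun x : ℝ => x ^ 2) (gaussianReal 0 1) :=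
    memLp_sq_gaussianReal.integrable (by norm_num)
  simp only [sumSq, stdNormal]
  rw [integral_finsetSum _ fun i _ => integrable_comp_eval (μ := fun _ => gaussianReal 0 1) hi]
  have : ∀ i : Fin n, ∫ x : Fin n → ℝ, x i ^ 2 ∂Measure.pi (fun _ => gaussianReal 0 1) = 1 := fun i =>
    (integral_comp_eval (μ := fun _ => gaussianReal 0 1) (f := fun x : ℝ => x ^ 2)
      (by fun_prop)).trans h1
  simp [this]

theorem memLp_sumSq (n : ℕ) : MemLp sumSq 2 (stdNormal n) :=
  memLp_finsetSum _ fun i _ =>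
    memLp_sq_gaussianReal.comp_measurePreserving
      (measurePreserving_eval (fun _ : Fin n => gaussianReal 0 1) i)

theorem integral_sumSq_sub_sq (n : ℕ) :
    ∫ x, (sumSq x - n) ^ 2 ∂stdNormal n = n * Var[fun x : ℝ => x ^ 2; gaussianReal 0 1] := by
  have h := variance_sum_pi (μ := fun _ : Fin n => gaussianReal 0 1)
    (X := fun _ x => x ^ 2) fun _ => memLp_sq_gaussianReal
  have h2 : (∑ i, fun ω : Fin n → ℝ => ω i ^ 2) = sumSq := by
    funext x; simp [sumSq]
  rw [h2] at h
  have h3 := variance_eq_integral (μ := stdNormal n) (X := sumSq) (by fun_prop)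
  rw [integral_sumSq] at h3
  rw [← h3, stdNormal, h]
  simp

theorem integrable_sumSq (n : ℕ) : Integrable sumSq (stdNormal n) :=
  (memLp_sumSq n).integrable (by norm_num)

theorem integrable_sumSq_sub_sq (n : ℕ) :
    Integrable (fun x => (sumSq x - n) ^ 2) (stdNormal n) :=
  ((memLp_sumSq n).sub (memLp_const (n : ℝ))).integrable_sq

/-- Integrate y ≤ c y²/2 + 1/(2c) over `A`, with y = S - n; the free `c` replaces Cauchy–Schwarz. -/
theorem setIntegral_sumSq_sub_le {n : ℕ} {A : Set (Fin n → ℝ)} {c : ℝ} (hc : 0 < c) :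
    ∫ x in A, (sumSq x - n) ∂stdNormal n ≤
      c / 2 * (n * Var[fun x : ℝ => x ^ 2; gaussianReal 0 1]) + (stdNormal n).real A / (2 * c) := by
  have hi := (integrable_sumSq_sub_sq n).const_mul (c / 2)
  calc ∫ x in A, (sumSq x - n) ∂stdNormal n
      ≤ ∫ x in A, (c / 2 * (sumSq x - n) ^ 2 + 1 / (2 * c)) ∂stdNormal n := by
        refine integral_mono ((integrable_sumSq n).sub (integrable_const _)).integrableOn
          (hi.add (integrable_const _)).integrableOn fun x => ?_
        have : c / 2 * (sumSq x - n) ^ 2 + 1 / (2 * c) - (sumSq x - n) =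
            (c * (sumSq x - n) - 1) ^ 2 / (2 * c) := by
          field_simp; ring
        have h2 : 0 ≤ (c * (sumSq x - n) - 1) ^ 2 / (2 * c) := by positivity
        dsimp only
        linarith
    _ = c / 2 * ∫ x in A, (sumSq x - n) ^ 2 ∂stdNormal n + (stdNormal n).real A / (2 * c) := by
        rw [integral_add hi.integrableOn (integrable_const _).integrableOn, integral_const_mul]
        simp [div_eq_mul_inv]
    _ ≤ _ := by
        rw [← integral_sumSq_sub_sq]
        gcongr
        · exact ae_of_all _ fun x => sq_nonneg _
        · exact integrable_sumSq_sub_sq n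
        · exact Measure.restrict_le_self

/-- Relative change of the chi-squared upper tail under a dilation of the threshold. -/
theorem stdNormal_tail_dilate {n : ℕ} (hn : 0 < n) {s κ β : ℝ} (hκ : 1 ≤ κ) (hβ : 0 < β)
    (hs : β ≤ (stdNormal n).real {x | s < sumSq x}) :
    (stdNormal n).real {x | s < sumSq x} * (Real.exp (-(n * (κ - 1) ^ 2 / 2)) *
      (1 - (Var[fun x : ℝ => x ^ 2; gaussianReal 0 1] + 1) / 4 * ((κ - 1) * √n / √β))) ≤
      (stdNormal n).real {x | κ * s < sumSq x} := by
  set K := Var[fun x : ℝ => x ^ 2; gaussianReal 0 1] with hK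
  set G := (stdNormal n).real {x | s < sumSq x} with hG
  have hK0 : 0 ≤ K := variance_nonneg _ _
  have hκ0 : 0 < κ := by linarith
  have hG0 : 0 < G := hβ.trans_le hs
  have hn' : (0 : ℝ) < n := by exact_mod_cast hn
  -- If the bracket is not positive, the left side is nonpositive and nothing is to be proved.
  rcases le_or_gt (1 - (K + 1) / 4 * ((κ - 1) * √n / √β)) 0 with hneg | hpos
  · refine le_trans ?_ measureReal_nonneg
    exact mul_nonpos_of_nonneg_of_nonpos hG0.le
      (mul_nonpos_of_nonneg_of_nonpos (Real.exp_pos _).le hneg)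
  have hA : MeasurableSet {x : Fin n → ℝ | κ * s < sumSq x} :=
    measurableSet_lt measurable_const measurable_sumSq
  have heq : (stdNormal n).real {x | κ * s < sumSq x} =
      √κ ^ n * ∫ x in {x | s < sumSq x}, Real.exp (-((κ - 1) / 2 * sumSq x)) ∂stdNormal n := by
    have h := stdNormal_apply_eq (Real.sqrt_pos.2 hκ0) hA
    have hset : {x : Fin n → ℝ | (fun i => √κ * x i) ∈ {x : Fin n → ℝ | κ * s < sumSq x}} =
        {x | s < sumSq x} := by
      ext x
      simp only [Set.mem_ofPred_eq, sumSq_const_mul, Real.sq_sqrt hκ0.le]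
      exact mul_lt_mul_iff_right₀ hκ0
    rw [hset, Real.sq_sqrt hκ0.le] at h
    rw [measureReal_def, h, ENNReal.toReal_mul, ENNReal.toReal_ofReal (by positivity),
      integral_eq_lintegral_of_nonneg_ae (ae_of_all _ fun x => (Real.exp_pos _).le) (by fun_prop)]
  -- The exponential is bounded below by its tangent line at the mean S = n.
  have hint : ∫ x in {x | s < sumSq x}, Real.exp (-((κ - 1) / 2 * n)) *
      (1 - (κ - 1) / 2 * (sumSq x - n)) ∂stdNormal n ≤
      ∫ x in {x | s < sumSq x}, Real.exp (-((κ - 1) / 2 * sumSq x)) ∂stdNormal n := by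
    refine integral_mono (((integrable_const _).sub
      (((integrable_sumSq n).sub (integrable_const _)).const_mul _)).const_mul _).integrableOn ?_
      fun x => ?_
    · refine Integrable.integrableOn (Integrable.of_bound (C := 1) (by fun_prop)
        (ae_of_all _ fun x => ?_))
      rw [Real.norm_of_nonneg (Real.exp_pos _).le, Real.exp_le_one_iff]
      have := mul_nonneg (by linarith : 0 ≤ (κ - 1) / 2) (sumSq_nonneg x)
      linarith
    · have h1 := Real.add_one_le_exp (-((κ - 1) / 2 * (sumSq x - n)))
      have h2 : Real.exp (-((κ - 1) / 2 * sumSq x)) = Real.exp (-((κ - 1) / 2 * n)) *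
          Real.exp (-((κ - 1) / 2 * (sumSq x - n))) := by
        rw [← Real.exp_add]; congr 1; ring
      dsimp only
      rw [h2]
      gcongr
      linarith
  have hint2 : ∫ x in {x | s < sumSq x}, Real.exp (-((κ - 1) / 2 * n)) *
      (1 - (κ - 1) / 2 * (sumSq x - n)) ∂stdNormal n = Real.exp (-((κ - 1) / 2 * n)) *
      (G - (κ - 1) / 2 * ∫ x in {x | s < sumSq x}, (sumSq x - n) ∂stdNormal n) := by
    have hi : IntegrableOn (fun x : Fin n → ℝ => (κ - 1) / 2 * (sumSq x - n))
        {x | s < sumSq x} (stdNormal n) :=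
      (((integrable_sumSq n).sub (integrable_const _)).const_mul _).integrableOn
    rw [integral_const_mul, integral_sub (integrable_const _).integrableOn hi,
      integral_const_mul]
    simp [hG]
  -- With c = √(β/n) both terms are of order √(n/β) · G, because β ≤ G.
  have hdev := setIntegral_sumSq_sub_le (n := n) (A := {x | s < sumSq x}) (c := √β / √n)
    (by positivity)
  have hdev2 : √β / √n / 2 * (n * K) + G / (2 * (√β / √n)) ≤ (K + 1) / 2 * (√n / √β) * G := by
    have h1 : √β / √n / 2 * (n * K) = K / 2 * (√n / √β) * β := by
      have e1 : √(n : ℝ) ^ 2 = n := Real.sq_sqrt hn'.le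
      have e2 : √β ^ 2 = β := Real.sq_sqrt hβ.le
      field_simp
      rw [e1, e2]
      ring
    have h2 : G / (2 * (√β / √n)) = 1 / 2 * (√n / √β) * G := by
      field_simp
    rw [h1, h2]
    have h3 : K / 2 * (√n / √β) * β ≤ K / 2 * (√n / √β) * G := by gcongr
    linarith
  have hinner : G * (1 - (K + 1) / 4 * ((κ - 1) * √n / √β)) ≤
      G - (κ - 1) / 2 * ∫ x in {x | s < sumSq x}, (sumSq x - n) ∂stdNormal n := by
    have h1 := mul_le_mul_of_nonneg_left (hdev.trans hdev2) (by linarith : 0 ≤ (κ - 1) / 2)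
    have h2 : (κ - 1) / 2 * ((K + 1) / 2 * (√n / √β) * G) =
      G * ((K + 1) / 4 * ((κ - 1) * √n / √β)) := by ring
    linarith
  -- Uses log κ ≥ 1 - 1/κ ≥ (κ - 1) - (κ - 1)²: the first-order terms cancel.
  have hfactor : Real.exp (-(n * (κ - 1) ^ 2 / 2)) ≤ √κ ^ n * Real.exp (-((κ - 1) / 2 * n)) := by
    have h1 : √κ ^ n = Real.exp (n * (Real.log κ / 2)) := by
      rw [← Real.log_sqrt hκ0.le, Real.exp_nat_mul, Real.exp_log (Real.sqrt_pos.2 hκ0)]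
    rw [h1, ← Real.exp_add]
    refine Real.exp_le_exp.2 ?_
    have h2 := Real.one_sub_inv_le_log_of_pos hκ0
    have h3 : κ - 1 - (κ - 1) ^ 2 ≤ 1 - κ⁻¹ := by
      have : 1 - κ⁻¹ - (κ - 1 - (κ - 1) ^ 2) = (κ - 1) ^ 3 / κ := by field_simp; ring
      have h4 : 0 ≤ (κ - 1) ^ 3 / κ := div_nonneg (pow_nonneg (by linarith) _) hκ0.le
      linarith
    have h5 := mul_le_mul_of_nonneg_left (h3.trans h2) hn'.le
    linarith
  rw [heq]
  calc _ = Real.exp (-(n * (κ - 1) ^ 2 / 2)) * (G * (1 - (K + 1) / 4 * ((κ - 1) * √n / √β))) := by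
        ring
    _ ≤ √κ ^ n * Real.exp (-((κ - 1) / 2 * n)) *
        (G - (κ - 1) / 2 * ∫ x in {x | s < sumSq x}, (sumSq x - n) ∂stdNormal n) := by
        gcongr
    _ ≤ _ := by
        rw [mul_assoc, ← hint2]
        gcongr

/-! ### The distribution of the `t`-statistic -/

@[fun_prop]
theorem measurable_sampleMean {n : ℕ} : Measurable (sampleMean (n := n)) := by
  unfold sampleMean; fun_prop

@[fun_prop]
theorem measurable_sampleVar {n : ℕ} : Measurable (sampleVar (n := n)) := by
  unfold sampleVar; fun_prop

@[fun_prop]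
theorem measurable_tStat {n : ℕ} : Measurable (tStat (n := n)) := by
  unfold tStat; fun_prop

theorem sampleMean_const_mul {n : ℕ} (c : ℝ) (x : Fin n → ℝ) :
    sampleMean (fun i => c * x i) = c * sampleMean x := by
  simp only [sampleMean, ← Finset.mul_sum, mul_div_assoc]

theorem sampleVar_const_mul {n : ℕ} (c : ℝ) (x : Fin n → ℝ) :
    sampleVar (fun i => c * x i) = c ^ 2 * sampleVar x := by
  simp only [sampleVar, sampleMean_const_mul, ← mul_sub, mul_pow, ← Finset.mul_sum, mul_div_assoc]

theorem tStat_const_mul {n : ℕ} {c : ℝ} (hc : 0 < c) (x : Fin n → ℝ) :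
    tStat (fun i => c * x i) = tStat x := by
  simp only [tStat, sampleMean_const_mul, sampleVar_const_mul]
  rw [Real.sqrt_mul (sq_nonneg c), Real.sqrt_sq hc.le, mul_left_comm, mul_div_mul_left _ _ hc.ne']

theorem tStat_neg {n : ℕ} (x : Fin n → ℝ) : tStat (fun i => -x i) = -tStat x := by
  have h1 := sampleMean_const_mul (-1) x
  have h2 := sampleVar_const_mul (-1) x
  simp only [neg_mul, one_mul, even_two, Even.neg_pow, one_pow] at h1 h2
  simp only [tStat, h1, h2]
  ring

theorem sum_sub_sampleMean_sq {n : ℕ} (hn : n ≠ 0) (x : Fin n → ℝ) :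
    ∑ j, (x j - sampleMean x) ^ 2 = sumSq x - n * sampleMean x ^ 2 := by
  have h1 : ∑ j, x j = n * sampleMean x := by
    rw [sampleMean, mul_div_cancel₀ _ (by exact_mod_cast hn)]
  have h2 : ∀ j, (x j - sampleMean x) ^ 2 =
      x j ^ 2 - 2 * sampleMean x * x j + sampleMean x ^ 2 := fun j => by ring
  simp only [h2, Finset.sum_add_distrib, Finset.sum_sub_distrib, ← Finset.mul_sum, h1, sumSq]
  simp
  ring

theorem exists_orthonormalBasis_zero_eq (k : ℕ) :
    ∃ b : OrthonormalBasis (Fin (k + 1)) ℝ (EuclideanSpace ℝ (Fin (k + 1))),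
      b 0 = WithLp.toLp 2 fun _ => 1 / √((k + 1 : ℕ) : ℝ) := by
  set v : EuclideanSpace ℝ (Fin (k + 1)) := WithLp.toLp 2 fun _ => 1 / √((k + 1 : ℕ) : ℝ) with hv
  have hnorm : ‖v‖ = 1 := by
    rw [← sq_eq_sq₀ (norm_nonneg _) zero_le_one, EuclideanSpace.real_norm_sq_eq]
    have : (0 : ℝ) < (k + 1 : ℕ) := by positivity
    simp only [hv, Finset.sum_const, Finset.card_univ, Fintype.card_fin, nsmul_eq_mul, div_pow,
      Real.sq_sqrt this.le]
    field_simp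
  have hon : Orthonormal ℝ (({0} : Set (Fin (k + 1))).domRestrict fun _ => v) := by
    refine ⟨fun i => hnorm, fun i j hij => ?_⟩
    exact absurd (Subsingleton.elim i j) hij
  obtain ⟨b, hb⟩ := hon.exists_orthonormalBasis_extension_of_card_eq (by simp)
  exact ⟨b, hb 0 rfl⟩

/-- Invariance of the standard Gaussian distribution under orthonormal change of coordinates. -/
theorem stdNormal_map_orthonormalBasis {n : ℕ}
    (b : OrthonormalBasis (Fin n) ℝ (EuclideanSpace ℝ (Fin n))) :
    (stdNormal n).map (fun x => WithLp.ofLp (∑ i, x i • b i)) = stdNormal n := by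
  have h := (map_pi_eq_stdGaussian (ι := Fin n)).trans (stdGaussian_eq_map_pi_orthonormalBasis b)
  have h2 := congrArg (fun μ => Measure.map (WithLp.ofLp (p := 2) (V := Fin n → ℝ)) μ) h
  simp only at h2
  rw [Measure.map_map (by fun_prop) (by fun_prop), Measure.map_map (by fun_prop) (by fun_prop)] at h2
  have h3 : (WithLp.ofLp (p := 2) (V := Fin n → ℝ)) ∘ WithLp.toLp 2 = id := rfl
  rw [h3, Measure.map_id] at h2
  exact h2.symm

/-- The first basis vector is the constant unit vector, so coordinate 0 is √n times the mean; by
Parseval the other k coordinates carry the residual sum of squares. -/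
theorem tStat_sum_smul {k : ℕ} (hk : k ≠ 0)
    {b : OrthonormalBasis (Fin (k + 1)) ℝ (EuclideanSpace ℝ (Fin (k + 1)))}
    (hb : b 0 = WithLp.toLp 2 fun _ => 1 / √((k + 1 : ℕ) : ℝ)) (x : Fin (k + 1) → ℝ) :
    tStat (WithLp.ofLp (∑ i, x i • b i)) = x 0 / √(sumSq (fun i : Fin k => x i.succ) / k) := by
  set y : EuclideanSpace ℝ (Fin (k + 1)) := ∑ i, x i • b i with hy
  have hpos : (0 : ℝ) < (k + 1 : ℕ) := by positivity
  have hsq : √((k + 1 : ℕ) : ℝ) ^ 2 = (k + 1 : ℕ) := Real.sq_sqrt hpos.le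
  have hspos : 0 < √((k + 1 : ℕ) : ℝ) := Real.sqrt_pos.2 hpos
  have h0 : inner ℝ (b 0) y = x 0 := by
    rw [hy]
    exact b.orthonormal.inner_right_fintype x 0
  have hmean : sampleMean (WithLp.ofLp y) = x 0 / √((k + 1 : ℕ) : ℝ) := by
    rw [hb] at h0
    simp only [PiLp.inner_apply, RCLike.inner_apply, conj_trivial] at h0
    rw [← h0, sampleMean, Finset.sum_div, Finset.sum_div]
    refine Finset.sum_congr rfl fun i _ => ?_
    rw [mul_one_div, div_div, ← sq, hsq]
  have hss : sumSq (WithLp.ofLp y) = sumSq x := by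
    have h1 : sumSq (WithLp.ofLp y) = ‖y‖ ^ 2 := (EuclideanSpace.real_norm_sq_eq y).symm
    rw [h1, ← b.sum_sq_norm_inner_right y]
    refine Finset.sum_congr rfl fun i _ => ?_
    rw [hy, b.orthonormal.inner_right_fintype x i]
    simp
  have hvar : sampleVar (WithLp.ofLp y) = sumSq (fun i : Fin k => x i.succ) / k := by
    rw [sampleVar, sum_sub_sampleMean_sq k.succ_ne_zero, hmean, hss, div_pow, hsq,
      mul_div_cancel₀ _ hpos.ne', sumSq, Fin.sum_univ_succ]
    simp [sumSq]
  rw [tStat, hmean, hvar, mul_div_cancel₀ _ hspos.ne']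

theorem stdNormal_map_tStat {n : ℕ} (hn : 2 ≤ n) :
    (stdNormal n).map tStat = studentT (n - 1) := by
  obtain ⟨k, rfl⟩ : ∃ k, n = k + 1 := ⟨n - 1, by omega⟩
  obtain ⟨b, hb⟩ := exists_orthonormalBasis_zero_eq k
  have hk : k ≠ 0 := by omega
  have hf : Measurable fun x : Fin (k + 1) → ℝ =>
    WithLp.ofLp (∑ i, x i • b i : EuclideanSpace ℝ (Fin (k + 1))) := by fun_prop
  rw [← stdNormal_map_orthonormalBasis b, Measure.map_map measurable_tStat hf]
  have h1 : tStat ∘ (fun x : Fin (k + 1) → ℝ =>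
      WithLp.ofLp (∑ i, x i • b i : EuclideanSpace ℝ (Fin (k + 1)))) =
      (fun z : ℝ × ℝ => z.1 / √(z.2 / k)) ∘ (Prod.map id sumSq) ∘
        (MeasurableEquiv.piFinSuccAbove (fun _ : Fin (k + 1) => ℝ) 0) := by
    funext x
    exact tStat_sum_smul hk hb x
  rw [h1, ← Measure.map_map (by fun_prop) (by fun_prop), ← Measure.map_map (by fun_prop) (by fun_prop),
    stdNormal, (measurePreserving_piFinSuccAbove (fun _ : Fin (k + 1) => gaussianReal 0 1) 0).map_eq,
    ← Measure.map_prod_map _ _ measurable_id measurable_sumSq, Measure.map_id]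
  rfl

instance (n : ℕ) : IsProbabilityMeasure (chiSq n) := by
  unfold chiSq
  exact Measure.isProbabilityMeasure_map measurable_sumSq.aemeasurable

instance (n : ℕ) : IsProbabilityMeasure (studentT n) := by
  unfold studentT
  exact Measure.isProbabilityMeasure_map (by fun_prop)

/-! ### Quantiles -/

theorem quantile_set_bddBelow (μ : Measure ℝ) [IsProbabilityMeasure μ] {p : ℝ} (hp : 0 < p) :
    BddBelow {x : ℝ | p ≤ μ.real (Set.Iic x)} := by
  obtain ⟨b, hb⟩ := ((tendsto_cdf_atBot μ).eventually_lt_const hp).exists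
  refine ⟨b, fun x hx => le_of_not_gt fun hlt => ?_⟩
  have h1 : p ≤ cdf μ x := by rw [cdf_eq_real]; exact hx
  exact (h1.trans ((monotone_cdf μ) hlt.le)).not_gt hb

theorem quantile_set_nonempty (μ : Measure ℝ) [IsProbabilityMeasure μ] {p : ℝ} (hp : p < 1) :
    {x : ℝ | p ≤ μ.real (Set.Iic x)}.Nonempty := by
  obtain ⟨b, hb⟩ := ((tendsto_cdf_atTop μ).eventually_const_lt hp).exists
  exact ⟨b, by rw [cdf_eq_real] at hb; exact hb.le⟩

theorem quantile_mono (μ : Measure ℝ) [IsProbabilityMeasure μ] {p r : ℝ} (hp : 0 < p)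
    (hpr : p ≤ r) (hr : r < 1) : quantile μ p ≤ quantile μ r :=
  csInf_le_csInf (quantile_set_bddBelow μ hp) (quantile_set_nonempty μ hr)
    fun _ hx => hpr.trans hx

/-- Right continuity of the distribution function passes the bound from points above the infimum to
the infimum. -/
theorem le_measureReal_Iic_quantile (μ : Measure ℝ) [IsProbabilityMeasure μ] {p : ℝ} (hp : p < 1) :
    p ≤ μ.real (Set.Iic (quantile μ p)) := by
  rw [← cdf_eq_real]
  have hlim : Tendsto (cdf μ) (𝓝[>] (quantile μ p)) (𝓝 (cdf μ (quantile μ p))) :=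
    ((cdf μ).right_continuous _).mono_left (nhdsWithin_mono _ Set.Ioi_subset_Ici_self)
  refine ge_of_tendsto hlim ?_
  filter_upwards [self_mem_nhdsWithin] with y hy
  obtain ⟨x, hx, hxy⟩ := exists_lt_of_csInf_lt (quantile_set_nonempty μ hp) hy
  have h1 : p ≤ cdf μ x := by rw [cdf_eq_real]; exact hx
  exact h1.trans (monotone_cdf μ hxy.le)

theorem measureReal_Ioi_quantile_le (μ : Measure ℝ) [IsProbabilityMeasure μ] {p : ℝ} (hp : p < 1) :
    μ.real (Set.Ioi (quantile μ p)) ≤ 1 - p := by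
  rw [← Set.compl_Iic, probReal_compl_eq_one_sub measurableSet_Iic]
  have := le_measureReal_Iic_quantile μ hp
  linarith

theorem le_measureReal_Ioi_of_lt_quantile (μ : Measure ℝ) [IsProbabilityMeasure μ] {p y : ℝ}
    (hp : 0 < p) (hy : y < quantile μ p) : 1 - p ≤ μ.real (Set.Ioi y) := by
  have h1 := notMem_of_lt_csInf hy (quantile_set_bddBelow μ hp)
  simp only [Set.mem_ofPred_eq, not_le] at h1
  rw [← Set.compl_Iic, probReal_compl_eq_one_sub measurableSet_Iic]
  linarith

theorem stdNormal_map_neg (n : ℕ) :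
    (stdNormal n).map (fun x i => -x i) = stdNormal n := by
  have h : (gaussianReal 0 1).map (fun x => -x) = gaussianReal 0 1 := by
    rw [gaussianReal_map_neg, neg_zero]
  have hm : IsProbabilityMeasure ((gaussianReal 0 1).map (fun x => -x)) := by
    rw [h]; infer_instance
  rw [stdNormal, Measure.pi_map_pi fun _ => by fun_prop]
  congr 1
  funext i
  exact h

/-- The two-sided `t`-test based on the `1 - p / 2` quantile has level `p`. -/
theorem stdNormal_abs_tStat_gt_quantile_le {n : ℕ} (hn : 2 ≤ n) {p : ℝ} (hp : 0 < p) :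
    stdNormal n {x | quantile (studentT (n - 1)) (1 - p / 2) < |tStat x|} ≤ ENNReal.ofReal p := by
  set t := quantile (studentT (n - 1)) (1 - p / 2) with ht
  have h1 : stdNormal n {x | t < tStat x} ≤ ENNReal.ofReal (p / 2) := by
    have : stdNormal n {x | t < tStat x} = studentT (n - 1) (Set.Ioi t) := by
      rw [← stdNormal_map_tStat hn, Measure.map_apply measurable_tStat measurableSet_Ioi]
      rfl
    rw [this, ← ofReal_measureReal]
    have h2 := measureReal_Ioi_quantile_le (studentT (n - 1)) (p := 1 - p / 2) (by linarith)
    refine ENNReal.ofReal_le_ofReal ?_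
    rw [ht]
    linarith
  have h2 : stdNormal n {x | t < -tStat x} = stdNormal n {x | t < tStat x} := by
    conv_rhs => rw [← stdNormal_map_neg n]
    rw [Measure.map_apply (by fun_prop) (measurableSet_lt measurable_const measurable_tStat)]
    simp only [Set.preimage_ofPred_eq, tStat_neg]
  calc _ ≤ stdNormal n ({x | t < tStat x} ∪ {x | t < -tStat x}) :=
        measure_mono fun x (hx : t < |tStat x|) => lt_abs.1 hx
    _ ≤ ENNReal.ofReal (p / 2) + ENNReal.ofReal (p / 2) :=
        (measure_union_le _ _).trans (add_le_add h1 (h2.le.trans h1))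
    _ = ENNReal.ofReal p := by
        rw [← ENNReal.ofReal_add (by positivity) (by positivity), add_halves]

end TwoStage

/-! ### Tails at the selection threshold and the finite-sample bound. -/

/-- A product measure over pairs is the iterated product measure. -/
theorem pi_map_uncurry {ι κ E : Type*} [Fintype ι] [Fintype κ] [MeasurableSpace E]
    (μ : ι → κ → Measure E) [∀ i j, IsProbabilityMeasure (μ i j)] :
    (Measure.pi fun i => Measure.pi (μ i)).map (fun x (p : ι × κ) => x p.1 p.2) =
      Measure.pi fun p : ι × κ => μ p.1 p.2 := by
  refine (Measure.pi_eq fun s hs => ?_).symm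
  rw [Measure.map_apply (by fun_prop) (MeasurableSet.univ_pi hs)]
  have : (fun (x : ι → κ → E) (p : ι × κ) => x p.1 p.2) ⁻¹' Set.univ.pi s =
      Set.univ.pi fun i => Set.univ.pi fun j => s (i, j) := by
    ext x
    simp [Set.mem_pi]
  rw [this, Measure.pi_pi, Fintype.prod_prod_type]
  exact Finset.prod_congr rfl fun i _ => Measure.pi_pi _ _

namespace TwoStage

theorem chiSq_Ioi (n : ℕ) (s : ℝ) :
    (chiSq n).real (Set.Ioi s) = (stdNormal n).real {x | s < sumSq x} := by
  rw [measureReal_def, chiSq, Measure.map_apply measurable_sumSq measurableSet_Ioi]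
  rfl

theorem selThreshold_nonneg {m : ℕ} (hm : 1 ≤ m) (n : ℕ) {γ : ℝ} (hγ : γ ≤ 1) :
    0 ≤ selThreshold m n γ := by
  have hm' : (1 : ℝ) ≤ m := by exact_mod_cast hm
  have hβ0 : 0 < (m : ℝ) ^ (γ - 1) := Real.rpow_pos_of_pos (by linarith) _
  have hβ1 : (m : ℝ) ^ (γ - 1) ≤ 1 := Real.rpow_le_one_of_one_le_of_nonpos hm' (by linarith)
  unfold selThreshold
  rcases hβ1.eq_or_lt with h | h
  -- Here m = 1 or γ = 1: level 0 gives the infimum of all of ℝ, which is 0 by default.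
  · rw [h, sub_self, quantile]
    simp
  · refine le_csInf (quantile_set_nonempty _ (by linarith)) fun x hx => ?_
    by_contra! hx0
    have h1 : (chiSq n).real (Set.Iic x) = 0 := by
      have : sumSq ⁻¹' Set.Iic x = (∅ : Set (Fin n → ℝ)) := by
        ext y
        simp only [Set.mem_preimage, Set.mem_Iic, Set.mem_empty_iff_false, iff_false, not_le]
        exact hx0.trans_le (sumSq_nonneg y)
      rw [measureReal_def, chiSq, Measure.map_apply measurable_sumSq measurableSet_Iic, this]
      simp
    have h2 : 1 - (m : ℝ) ^ (γ - 1) ≤ (chiSq n).real (Set.Iic x) := hx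
    linarith

/-- Supplies the lower bound β on the tail at (1 - δ)u. Staying strictly below the quantile avoids
any continuity of the chi-squared law. -/
theorem le_tail_of_lt_selThreshold {m : ℕ} (hm : 1 ≤ m) (n : ℕ) {γ s : ℝ} (hγ : γ ≤ 1)
    (hs0 : 0 ≤ s) (hs : s < selThreshold m n γ) :
    (m : ℝ) ^ (γ - 1) ≤ (stdNormal n).real {x | s < sumSq x} := by
  have hm' : (1 : ℝ) ≤ m := by exact_mod_cast hm
  have hβ1 : (m : ℝ) ^ (γ - 1) ≤ 1 := Real.rpow_le_one_of_one_le_of_nonpos hm' (by linarith)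
  have hβ : (m : ℝ) ^ (γ - 1) < 1 := by
    refine lt_of_le_of_ne hβ1 fun h => ?_
    rw [selThreshold, h, sub_self, quantile] at hs
    simp at hs
    linarith
  have := le_measureReal_Ioi_of_lt_quantile (chiSq n) (by linarith) hs
  rw [chiSq_Ioi] at this
  linarith

/-- Lower bound for the ratio of the chi-squared tails at `(1 ± δ)` times the threshold. -/
noncomputable def tailRatioBound (m n : ℕ) (γ δ : ℝ) : ℝ :=
  Real.exp (-(8 * (n * δ ^ 2))) *
    (1 - (Var[fun x : ℝ => x ^ 2; gaussianReal 0 1] + 1) * (δ * √n / √((m : ℝ) ^ (γ - 1))))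

theorem tailRatioBound_le_one (m n : ℕ) (γ : ℝ) {δ : ℝ} (hδ : 0 ≤ δ) :
    tailRatioBound m n γ δ ≤ 1 := by
  have hK : 0 ≤ Var[fun x : ℝ => x ^ 2; gaussianReal 0 1] := variance_nonneg _ _
  have h1 : 0 ≤ 8 * (n * δ ^ 2) := by positivity
  have h2 : 0 ≤ (Var[fun x : ℝ => x ^ 2; gaussianReal 0 1] + 1) *
    (δ * √n / √((m : ℝ) ^ (γ - 1))) := by positivity
  calc tailRatioBound m n γ δ ≤ Real.exp (-(8 * (n * δ ^ 2))) * 1 := by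
        unfold tailRatioBound
        gcongr
        linarith
    _ ≤ 1 := by
        rw [mul_one, Real.exp_le_one_iff]
        linarith

theorem tail_mul_tailRatioBound_le {m n : ℕ} (hm : 1 ≤ m) (hn : 0 < n) {γ δ : ℝ} (hγ : γ ≤ 1)
    (hδ0 : 0 < δ) (hδ : δ ≤ 1 / 2) :
    (stdNormal n).real {x | (1 - δ) * selThreshold m n γ < sumSq x} * tailRatioBound m n γ δ ≤
      (stdNormal n).real {x | (1 + δ) * selThreshold m n γ < sumSq x} := by
  have hK0 : 0 ≤ Var[fun x : ℝ => x ^ 2; gaussianReal 0 1] := variance_nonneg _ _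
  set K := Var[fun x : ℝ => x ^ 2; gaussianReal 0 1]
  have hβ : 0 < (m : ℝ) ^ (γ - 1) := Real.rpow_pos_of_pos (by exact_mod_cast hm) _
  have hu := selThreshold_nonneg hm n hγ
  rcases hu.eq_or_lt with h0 | hpos
  · rw [← h0, mul_zero, mul_zero]
    exact mul_le_of_le_one_right measureReal_nonneg (tailRatioBound_le_one m n γ hδ0.le)
  · set u := selThreshold m n γ with hu_def
    set κ := (1 + δ) / (1 - δ) with hκ
    have h1δ : 0 < 1 - δ := by linarith
    -- This 4δ, valid for δ ≤ 1/2, produces the constants in `tailRatioBound`: 8 = 4²/2 and K + 1 =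
    -- 4 · (K + 1)/4.
    have hκ1 : κ - 1 ≤ 4 * δ := by
      have : κ - 1 = 2 * δ / (1 - δ) := by rw [hκ]; field_simp; ring
      rw [this, div_le_iff₀ h1δ]
      nlinarith
    have hκ0 : 1 ≤ κ := by
      rw [hκ, le_div_iff₀ h1δ]; linarith
    have hG := le_tail_of_lt_selThreshold hm n hγ (s := (1 - δ) * u) (by positivity)
      (by rw [← hu_def]; nlinarith)
    have h := stdNormal_tail_dilate hn hκ0 hβ hG
    have hκs : κ * ((1 - δ) * u) = (1 + δ) * u := by
      rw [hκ]; field_simp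
    rw [hκs] at h
    rcases le_or_gt (1 - (K + 1) * (δ * √n / √((m : ℝ) ^ (γ - 1)))) 0 with hneg | hp
    · refine le_trans ?_ measureReal_nonneg
      exact mul_nonpos_of_nonneg_of_nonpos measureReal_nonneg
        (mul_nonpos_of_nonneg_of_nonpos (Real.exp_pos _).le hneg)
    · refine le_trans ?_ h
      unfold tailRatioBound
      have hsq : (κ - 1) ^ 2 ≤ 16 * δ ^ 2 := by nlinarith
      gcongr ?_ * (Real.exp (-?_) * (1 - ?_))
      · nlinarith [(Nat.cast_pos (α := ℝ)).2 hn]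
      · calc (K + 1) / 4 * ((κ - 1) * √n / √((m : ℝ) ^ (γ - 1)))
            ≤ (K + 1) / 4 * ((4 * δ) * √n / √((m : ℝ) ^ (γ - 1))) := by gcongr
          _ = _ := by ring

theorem map_stdNormal_const_mul (n : ℕ) (σ : ℝ≥0) :
    (stdNormal n).map (fun x i => (σ : ℝ) * x i) = Measure.pi fun _ => gaussianReal 0 (σ ^ 2) := by
  have h : (gaussianReal 0 1).map (fun x => (σ : ℝ) * x) = gaussianReal 0 (σ ^ 2) := by
    rw [gaussianReal_map_const_mul, mul_zero]
    congr 1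
    ext
    simp
  have hm : IsProbabilityMeasure ((gaussianReal 0 1).map (fun x => (σ : ℝ) * x)) := by
    rw [h]; infer_instance
  rw [stdNormal, Measure.pi_map_pi fun _ => by fun_prop]
  congr 1
  funext i
  exact h

theorem pi_gaussianReal_sumSq {n : ℕ} {σ : ℝ≥0} (hσ : 0 < σ) {D : Set ℝ} (hD : MeasurableSet D) :
    (Measure.pi fun _ : Fin n => gaussianReal 0 (σ ^ 2)) {x | sumSq x / (σ : ℝ) ^ 2 ∈ D} =
      stdNormal n (sumSq ⁻¹' D) := by
  have hσ2 : (σ : ℝ) ^ 2 ≠ 0 := by positivity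
  have hm : Measurable fun x : Fin n → ℝ => sumSq x / (σ : ℝ) ^ 2 := by fun_prop
  have hmD : MeasurableSet {x : Fin n → ℝ | sumSq x / (σ : ℝ) ^ 2 ∈ D} := hm hD
  rw [← map_stdNormal_const_mul, Measure.map_apply (by fun_prop) hmD]
  simp only [Set.preimage_ofPred_eq, sumSq_const_mul, mul_div_cancel_left₀ _ hσ2]
  rfl

/-- For centred normal samples, the sum of squares is independent of the `t`-test. -/
theorem pi_gaussianReal_sumSq_inter_tStat_le {n : ℕ} (hn : 2 ≤ n) {σ : ℝ≥0} (hσ : 0 < σ) {p : ℝ}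
    (hp : 0 < p) {D : Set ℝ} (hD : MeasurableSet D) :
    (Measure.pi fun _ : Fin n => gaussianReal 0 (σ ^ 2))
      ({x | sumSq x / (σ : ℝ) ^ 2 ∈ D} ∩
        {x | quantile (studentT (n - 1)) (1 - p / 2) < |tStat x|}) ≤
      stdNormal n (sumSq ⁻¹' D) * ENNReal.ofReal p := by
  have hσ' : (0 : ℝ) < σ := hσ
  have hσ2 : (σ : ℝ) ^ 2 ≠ 0 := by positivity
  have hm : Measurable fun x : Fin n → ℝ => sumSq x / (σ : ℝ) ^ 2 := by fun_prop
  have hA : MeasurableSet {x : Fin n → ℝ | quantile (studentT (n - 1)) (1 - p / 2) < |tStat x|} :=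
    measurableSet_lt measurable_const (by fun_prop)
  have hmD : MeasurableSet {x : Fin n → ℝ | sumSq x / (σ : ℝ) ^ 2 ∈ D} := hm hD
  rw [← map_stdNormal_const_mul, Measure.map_apply (by fun_prop) (hmD.inter hA)]
  simp only [Set.preimage_inter, Set.preimage_ofPred_eq, sumSq_const_mul, tStat_const_mul hσ',
    mul_div_cancel_left₀ _ hσ2]
  refine (stdNormal_inter_sumSq (by omega) hA (fun c hc x => by
    simp only [Set.mem_ofPred_eq, tStat_const_mul hc]) hD).le.trans ?_
  gcongr
  exact stdNormal_abs_tStat_gt_quantile_le hn hp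

/-- Joint law of independent normal samples with a common variance. -/
theorem map_samples_eq_pi {Ω : Type*} [MeasurableSpace Ω] {P : Measure Ω} [IsProbabilityMeasure P]
    {m n : ℕ} {mean : Fin m → ℝ} {v : ℝ≥0} {X : Fin m → Fin n → Ω → ℝ}
    (hX : ∀ i j, HasLaw (X i j) (gaussianReal (mean i) v) P)
    (hindep : iIndepFun (fun p : Fin m × Fin n => X p.1 p.2) P) :
    P.map (fun ω i j => X i j ω) =
      Measure.pi fun i => Measure.pi fun _ : Fin n => gaussianReal (mean i) v := by
  have hae : ∀ p : Fin m × Fin n, AEMeasurable (X p.1 p.2) P := fun p => (hX p.1 p.2).aemeasurable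
  have h1 := hindep.map_fun_eq_pi_map hae
  simp only [(hX _ _).map_eq] at h1
  rw [← pi_map_uncurry fun i (_ : Fin n) => gaussianReal (mean i) v] at h1
  have h2 := congrArg (fun μ => Measure.map (fun (x : Fin m × Fin n → ℝ) i j => x (i, j)) μ) h1
  have hcurry : Measurable fun (x : Fin m × Fin n → ℝ) (i : Fin m) (j : Fin n) => x (i, j) := by
    fun_prop
  rw [AEMeasurable.map_map_of_aemeasurable hcurry.aemeasurable (aemeasurable_pi_lambda _ hae),
    Measure.map_map (by fun_prop) (by fun_prop)] at h2
  exact h2.trans Measure.map_id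

/-- Pointwise comparison of the data-driven selection with the selections at fixed thresholds. -/
theorem exists_mem_region_of_mem_rejected {m n : ℕ} {α γ s2 v δ : ℝ} (hα0 : 0 < α) (hα1 : α < 1)
    (hv : 0 < v) (hu : 0 ≤ selThreshold m n γ) (hs2 : |s2 - v| ≤ v * δ) {J : Finset (Fin m)}
    {x : Fin m → Fin n → ℝ} {i : Fin m} (hi : i ∈ rejected α γ s2 x)
    [DecidablePred fun y : Fin n → ℝ => sumSq y / v ∈ Set.Ioi ((1 + δ) * selThreshold m n γ)] :
    sumSq (x i) / v ∈ Set.Ioi ((1 - δ) * selThreshold m n γ) ∧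
      quantile (studentT (n - 1)) (1 - α / (max 1
        (J.filter fun j => sumSq (x j) / v ∈ Set.Ioi ((1 + δ) * selThreshold m n γ)).card : ℕ) / 2)
        < |tStat (x i)| := by
  obtain ⟨hsel, hrej⟩ := Finset.mem_filter.1 hi
  have hsel' : s2 * selThreshold m n γ < sumSq (x i) := (Finset.mem_filter.1 hsel).2
  have habs := abs_le.1 hs2
  constructor
  · rw [Set.mem_Ioi, lt_div_iff₀ hv]
    refine lt_of_le_of_lt ?_ hsel'
    calc (1 - δ) * selThreshold m n γ * v = (v - v * δ) * selThreshold m n γ := by ring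
      _ ≤ s2 * selThreshold m n γ := by gcongr; linarith
  · refine lt_of_le_of_lt ?_ hrej
    set k := (selected γ s2 x).card with hk
    have hk1 : 1 ≤ k := Finset.card_pos.2 ⟨i, hsel⟩
    -- Everything above the upper threshold is selected, so the count over `J` is at most k; a
    -- smaller count means a smaller quantile and a larger rejection region.
    have hsub : (J.filter fun j => sumSq (x j) / v ∈ Set.Ioi ((1 + δ) * selThreshold m n γ)) ⊆ selected γ s2 x := by
      intro j hj
      have hj2 := (Finset.mem_filter.1 hj).2
      rw [Set.mem_Ioi, lt_div_iff₀ hv] at hj2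
      refine Finset.mem_filter.2 ⟨Finset.mem_univ _, lt_of_le_of_lt ?_ hj2⟩
      calc s2 * selThreshold m n γ ≤ (v + v * δ) * selThreshold m n γ := by gcongr; linarith
        _ = (1 + δ) * selThreshold m n γ * v := by ring
    set N := max 1 (J.filter fun j => sumSq (x j) / v ∈ Set.Ioi ((1 + δ) * selThreshold m n γ)).card with hN
    have hNk : N ≤ k := max_le hk1 (Finset.card_le_card hsub)
    have hN1 : 1 ≤ N := le_max_left _ _
    have hN1' : (1 : ℝ) ≤ N := by exact_mod_cast hN1
    have hNk' : (N : ℝ) ≤ k := by exact_mod_cast hNk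
    have hk0 : (0 : ℝ) < k := by linarith
    refine quantile_mono _ ?_ ?_ ?_
    · have : α / N ≤ α := div_le_self hα0.le hN1'
      linarith
    · rw [mul_comm 2 (k : ℝ), ← div_div]
      gcongr
    · have : 0 < α / (2 * (k : ℝ)) := by positivity
      linarith

/-- Finite-sample bound for the familywise error rate of the two-stage procedure with estimated
variance. -/
theorem fwer_le {Ω : Type*} [MeasurableSpace Ω] {P : Measure Ω} [IsProbabilityMeasure P]
    {m n : ℕ} (hm : 1 ≤ m) (hn : 2 ≤ n) {mean : Fin m → ℝ} {σ : ℝ≥0} (hσ : 0 < σ)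
    {X : Fin m → Fin n → Ω → ℝ} (hX : ∀ i j, HasLaw (X i j) (gaussianReal (mean i) (σ ^ 2)) P)
    (hindep : iIndepFun (fun p : Fin m × Fin n => X p.1 p.2) P) {σ2hat : Ω → ℝ}
    {α γ δ : ℝ} (hα0 : 0 < α) (hα1 : α < 1) (hγ : γ ≤ 1) (hδ0 : 0 < δ) (hδ : δ ≤ 1 / 2)
    (hη : 0 < tailRatioBound m n γ δ) :
    fwer P α γ mean X σ2hat ≤ P {ω | (σ : ℝ) ^ 2 * δ < |σ2hat ω - (σ : ℝ) ^ 2|} +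
      ENNReal.ofReal (α * (1 + 2 * ((tailRatioBound m n γ δ)⁻¹ - 1))) := by
  classical
  set u := selThreshold m n γ with hu_def
  set η := tailRatioBound m n γ δ with hη_def
  have hu := selThreshold_nonneg hm n hγ
  have hv : (0 : ℝ) < (σ : ℝ) ^ 2 := by positivity
  have hm1 : Measurable fun x : Fin n → ℝ => sumSq x / (σ : ℝ) ^ 2 := by fun_prop
  set B : Set (Fin n → ℝ) := {x | sumSq x / (σ : ℝ) ^ 2 ∈ Set.Ioi ((1 - δ) * u)} with hB_def
  set C : Set (Fin n → ℝ) := {x | sumSq x / (σ : ℝ) ^ 2 ∈ Set.Ioi ((1 + δ) * u)} with hC_def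
  set R : ℕ → Set (Fin n → ℝ) := fun k =>
    {x | quantile (studentT (n - 1)) (1 - α / k / 2) < |tStat x|} with hR_def
  set J : Finset (Fin m) := {i | mean i = 0} with hJ
  set Q : Measure (Fin m → Fin n → ℝ) :=
    Measure.pi fun i => Measure.pi fun _ : Fin n => gaussianReal (mean i) (σ ^ 2) with hQ
  set q := stdNormal n (sumSq ⁻¹' Set.Ioi ((1 + δ) * u)) with hq_def
  have hBm : MeasurableSet B := hm1 measurableSet_Ioi
  have hCm : MeasurableSet C := hm1 measurableSet_Ioi
  have hBC : B \ C = {x | sumSq x / (σ : ℝ) ^ 2 ∈ Set.Ioc ((1 - δ) * u) ((1 + δ) * u)} := by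
    ext x
    simp [hB_def, hC_def]
  have hlt : (1 - δ) * u ≤ (1 + δ) * u := by gcongr; linarith
  have htail := tail_mul_tailRatioBound_le hm (by omega : 0 < n) (γ := γ) hγ hδ0 hδ
  rw [← hu_def, ← hη_def] at htail
  have hη1 : 0 ≤ η⁻¹ - 1 :=
    sub_nonneg.2 ((one_le_inv₀ hη).2 (tailRatioBound_le_one m n γ hδ0.le))
  -- The tail-ratio bound gives P(S > (1-δ)u) ≤ η⁻¹ q; subtracting q leaves the shell, so ρ = η⁻¹ -
  -- 1.
  have hshell : stdNormal n (sumSq ⁻¹' Set.Ioc ((1 - δ) * u) ((1 + δ) * u)) ≤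
      ENNReal.ofReal (η⁻¹ - 1) * q := by
    have hsub : {x : Fin n → ℝ | (1 + δ) * u < sumSq x} ⊆ {x | (1 - δ) * u < sumSq x} :=
      fun x hx => lt_of_le_of_lt hlt hx
    have hdiff : sumSq (n := n) ⁻¹' Set.Ioc ((1 - δ) * u) ((1 + δ) * u) =
        {x | (1 - δ) * u < sumSq x} \ {x | (1 + δ) * u < sumSq x} := by
      ext x
      simp
    rw [hq_def, ← ofReal_measureReal, ← ofReal_measureReal, ← ENNReal.ofReal_mul hη1, hdiff,
      measureReal_sdiff hsub
        (measurableSet_lt measurable_const measurable_sumSq)]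
    refine ENNReal.ofReal_le_ofReal ?_
    rw [← le_div_iff₀ hη, div_eq_inv_mul] at htail
    rw [sub_mul (η⁻¹), one_mul]
    exact sub_le_sub_right htail _
  have hmarg : ∀ i ∈ J, ∀ A : Set (Fin n → ℝ), MeasurableSet A →
      Q ((fun x => x i) ⁻¹' A) = (Measure.pi fun _ : Fin n => gaussianReal 0 (σ ^ 2)) A := by
    intro i hi A hA
    have h := (measurePreserving_eval (fun i => Measure.pi fun _ : Fin n =>
      gaussianReal (mean i) (σ ^ 2)) i).measure_preimage hA.nullMeasurableSet
    rw [(Finset.mem_filter.1 hi).2] at h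
    exact h
  have hDm : MeasurableSet
      {x : Fin n → ℝ | sumSq x / (σ : ℝ) ^ 2 ∈ Set.Ioc ((1 - δ) * u) ((1 + δ) * u)} :=
    hm1 measurableSet_Ioc
  have hRm : ∀ k, MeasurableSet (R k) := fun k => measurableSet_lt measurable_const (by fun_prop)
  have hlevel : ∀ k : ℕ, 1 ≤ k → 0 < α / k ∧
      ENNReal.ofReal (α / k) = ENNReal.ofReal α / (k : ℝ≥0∞) := by
    intro k hk
    have hk0 : (0 : ℝ) < k := by exact_mod_cast hk
    exact ⟨by positivity, by rw [ENNReal.ofReal_div_of_pos hk0, ENNReal.ofReal_natCast]⟩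
  have hmain : Q {x | ∃ i ∈ J, x i ∈ B ∧ x i ∈ R (max 1 (J.filter fun j => x j ∈ C).card)} ≤
      ENNReal.ofReal α * (1 + 2 * ENNReal.ofReal (η⁻¹ - 1)) := by
    refine measure_exists_mem_region_le (X := fun i (x : Fin m → Fin n → ℝ) => x i)
      (fun i => measurable_pi_apply i)
      (iIndepFun_pi (X := fun _ => id) fun _ => aemeasurable_id) J hBm hCm hRm (q := q) ?_ ?_ ?_
    · intro i hi
      rw [hmarg i hi _ hCm]
      exact pi_gaussianReal_sumSq hσ measurableSet_Ioi
    · intro i hi k hk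
      rw [hmarg i hi _ (hCm.inter (hRm k)), ← (hlevel k hk).2]
      exact pi_gaussianReal_sumSq_inter_tStat_le hn hσ (hlevel k hk).1 measurableSet_Ioi
    · intro i hi k hk
      rw [hBC, hmarg i hi _ (hDm.inter (hRm k)), ← (hlevel k hk).2]
      refine (pi_gaussianReal_sumSq_inter_tStat_le hn hσ (hlevel k hk).1 measurableSet_Ioc).trans ?_
      gcongr
  have hae : AEMeasurable (fun ω i j => X i j ω) P :=
    aemeasurable_pi_lambda _ fun i => aemeasurable_pi_lambda _ fun j => (hX i j).aemeasurable
  calc fwer P α γ mean X σ2hat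
      ≤ P ({ω | (σ : ℝ) ^ 2 * δ < |σ2hat ω - (σ : ℝ) ^ 2|} ∪ (fun ω i j => X i j ω) ⁻¹'
        {x | ∃ i ∈ J, x i ∈ B ∧ x i ∈ R (max 1 (J.filter fun j => x j ∈ C).card)}) := by
        refine measure_mono ?_
        rintro ω ⟨i, hi0, hi⟩
        by_cases hbad : (σ : ℝ) ^ 2 * δ < |σ2hat ω - (σ : ℝ) ^ 2|
        · exact Or.inl hbad
        · right
          obtain ⟨h1, h2⟩ := exists_mem_region_of_mem_rejected (J := J) hα0 hα1 hv hu
            (not_lt.1 hbad) hi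
          exact ⟨i, by simp [hJ, hi0], h1, h2⟩
    _ ≤ _ := measure_union_le _ _
    _ ≤ _ := by
        gcongr
        refine (Measure.le_map_apply hae _).trans ?_
        rw [map_samples_eq_pi hX hindep]
        refine hmain.trans_eq ?_
        rw [ENNReal.ofReal_mul hα0.le, ENNReal.ofReal_add zero_le_one (by positivity),
          ENNReal.ofReal_mul zero_le_two, ENNReal.ofReal_one, ENNReal.ofReal_ofNat]

/-! ### Passage to the limit. -/

/-- For δ = D/√(mn) the sample size cancels: nδ² = D²/m, and δ√n/√β = D m^(-1/2) m^((1-γ)/2) = D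
m^(-γ/2). -/
theorem tendsto_tailRatioBound (n : ℕ → ℕ) (hn : ∀ m, 2 ≤ n m) {γ : ℝ} (hγ : 0 < γ) (D : ℝ) :
    Tendsto (fun m : ℕ => tailRatioBound m (n m) γ (D * (1 / √((m : ℝ) * n m)))) atTop (𝓝 1) := by
  set K := Var[fun x : ℝ => x ^ 2; gaussianReal 0 1] with hK
  have h1 : Tendsto (fun m : ℕ => D ^ 2 / (m : ℝ)) atTop (𝓝 0) :=
    tendsto_const_div_atTop_nhds_zero_nat _
  have h2 : Tendsto (fun m : ℕ => (m : ℝ) ^ (-(γ / 2))) atTop (𝓝 0) :=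
    (tendsto_rpow_neg_atTop (by positivity)).comp tendsto_natCast_atTop_atTop
  have h3 : Tendsto (fun m : ℕ => Real.exp (-(8 * (D ^ 2 / (m : ℝ)))) *
      (1 - (K + 1) * (D * (m : ℝ) ^ (-(γ / 2))))) atTop
      (𝓝 (Real.exp (-(8 * 0)) * (1 - (K + 1) * (D * 0)))) :=
    (h1.const_mul 8).neg.rexp.mul ((h2.const_mul D).const_mul (K + 1) |>.const_sub 1)
  simp only [mul_zero, neg_zero, Real.exp_zero, sub_zero, mul_one] at h3
  refine h3.congr' ?_
  filter_upwards [eventually_ge_atTop 1] with m hm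
  have hm0 : (0 : ℝ) < m := by exact_mod_cast hm
  have hn0 : (0 : ℝ) < n m := by have := hn m; exact_mod_cast (by omega : 0 < n m)
  have e1 : (n m : ℝ) * (D * (1 / √((m : ℝ) * n m))) ^ 2 = D ^ 2 / m := by
    rw [mul_pow, div_pow, Real.sq_sqrt (by positivity)]
    field_simp
  have e2 : D * (1 / √((m : ℝ) * n m)) * √(n m) / √((m : ℝ) ^ (γ - 1)) =
      D * (m : ℝ) ^ (-(γ / 2)) := by
    rw [Real.sqrt_mul hm0.le, Real.sqrt_eq_rpow ((m : ℝ) ^ (γ - 1)), ← Real.rpow_mul hm0.le,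
      Real.sqrt_eq_rpow (m : ℝ)]
    have : √(n m : ℝ) ≠ 0 := by positivity
    have e3 : (m : ℝ) ^ (-(γ / 2)) = ((m : ℝ) ^ (1 / 2 : ℝ))⁻¹ / (m : ℝ) ^ ((γ - 1) * (1 / 2)) := by
      rw [← Real.rpow_neg hm0.le, ← Real.rpow_sub hm0]
      congr 1
      ring
    rw [e3]
    field_simp
  rw [tailRatioBound, e1, e2]

/-- The two-stage procedure with a `√(mn)`-consistent variance estimator asymptotically controls
the familywise error rate, for every selection exponent `γ ∈ (0, 1]` and all sample sizes `≥ 2`: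
passing from the threshold `(1 - δ) u` to `(1 + δ) u` with `δ = O(1 / √(mn))` changes the tail
probability of a null sum of squares only by the relative amount `O(m ^ (-γ / 2))`. -/
theorem limsup_fwer_le {Ω : ℕ → Type*} [∀ m, MeasurableSpace (Ω m)]
    {P : ∀ m, Measure (Ω m)} [∀ m, IsProbabilityMeasure (P m)] {n : ℕ → ℕ} (hn : ∀ m, 2 ≤ n m)
    {mean : ∀ m, Fin m → ℝ} {σ : ℝ≥0} (hσ : 0 < σ) {X : ∀ m, Fin m → Fin (n m) → Ω m → ℝ}
    (hX : ∀ m i j, HasLaw (X m i j) (gaussianReal (mean m i) (σ ^ 2)) (P m))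
    (hindep : ∀ m, iIndepFun (fun p : Fin m × Fin (n m) => X m p.1 p.2) (P m))
    {σ2hat : ∀ m, Ω m → ℝ}
    (hσ2hat : IsBigOP P (fun m ω => σ2hat m ω - (σ : ℝ) ^ 2) fun m => 1 / √((m : ℝ) * n m))
    {α : ℝ} (hα0 : 0 < α) (hα1 : α < 1) {γ : ℝ} (hγ0 : 0 < γ) (hγ1 : γ ≤ 1) :
    limsup (fun m => fwer (P m) α γ (mean m) (X m) (σ2hat m)) atTop ≤ ENNReal.ofReal α := by
  refine ENNReal.le_of_forall_pos_le_add fun ε hε _ => ?_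
  obtain ⟨C, hC⟩ := hσ2hat ε (by exact_mod_cast hε)
  have hv : (0 : ℝ) < (σ : ℝ) ^ 2 := by positivity
  -- The constant `C` may be nonpositive; the maximum with 1 keeps δ > 0.
  set D := max C 1 / (σ : ℝ) ^ 2 with hD
  have hD0 : 0 < D := div_pos (lt_max_of_lt_right one_pos) hv
  set δ : ℕ → ℝ := fun m => D * (1 / √((m : ℝ) * n m)) with hδ_def
  set η : ℕ → ℝ := fun m => tailRatioBound m (n m) γ (δ m) with hη_def
  have hη : Tendsto η atTop (𝓝 1) := tendsto_tailRatioBound n hn hγ0 D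
  have hδ : Tendsto δ atTop (𝓝 0) := by
    have h1 : Tendsto (fun m : ℕ => D * (1 / √(m : ℝ))) atTop (𝓝 (D * 0)) := by
      refine Tendsto.const_mul D ?_
      simp only [one_div]
      exact tendsto_inv_atTop_zero.comp (Real.tendsto_sqrt_atTop.comp tendsto_natCast_atTop_atTop)
    rw [mul_zero] at h1
    refine squeeze_zero' (Eventually.of_forall fun m => by positivity) ?_ h1
    filter_upwards [eventually_ge_atTop 1] with m hm
    have hm0 : (0 : ℝ) < m := by exact_mod_cast hm
    have hn1 : (1 : ℝ) ≤ n m := by have := hn m; exact_mod_cast (by omega : 1 ≤ n m)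
    simp only [hδ_def]
    gcongr
    exact le_mul_of_one_le_right hm0.le hn1
  have hbound : ∀ᶠ m in atTop, fwer (P m) α γ (mean m) (X m) (σ2hat m) ≤
      ε + ENNReal.ofReal (α * (1 + 2 * ((η m)⁻¹ - 1))) := by
    filter_upwards [hC, hη.eventually_const_lt one_pos,
      hδ.eventually_lt_const (by norm_num : (0 : ℝ) < 1 / 2), eventually_ge_atTop 1]
      with m hCm hηm hδm hm
    have hm0 : (0 : ℝ) < m := by exact_mod_cast hm
    have hn0 : (0 : ℝ) < n m := by have := hn m; exact_mod_cast (by omega : 0 < n m)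
    have hδ0 : 0 < δ m := by positivity
    refine (fwer_le hm (hn m) hσ (hX m) (hindep m) hα0 hα1 hγ1 hδ0 hδm.le hηm).trans ?_
    gcongr
    rw [ENNReal.ofReal_coe_nnreal] at hCm
    refine le_trans (measure_mono ?_) hCm
    intro ω hω
    refine lt_of_le_of_lt ?_ (show (σ : ℝ) ^ 2 * δ m < |σ2hat m ω - (σ : ℝ) ^ 2| from hω)
    have : (σ : ℝ) ^ 2 * δ m = max C 1 * (1 / √((m : ℝ) * n m)) := by
      simp only [hδ_def, hD]
      field_simp
    rw [this]
    gcongr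
    exact le_max_left _ _
  have hlim : Tendsto (fun m => (ε : ℝ≥0∞) + ENNReal.ofReal (α * (1 + 2 * ((η m)⁻¹ - 1)))) atTop
      (𝓝 (ε + ENNReal.ofReal (α * (1 + 2 * ((1 : ℝ)⁻¹ - 1))))) := by
    refine tendsto_const_nhds.add (ENNReal.tendsto_ofReal ?_)
    exact ((((hη.inv₀ one_ne_zero).sub_const 1).const_mul 2).const_add 1).const_mul α
  calc _ ≤ _ := limsup_le_limsup hbound
    _ = _ := hlim.limsup_eq
    _ = ENNReal.ofReal α + ε := by simp [add_comm]

end TwoStage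

theorem theorem5p1
    {Ω : ℕ → Type*} [∀ m, MeasurableSpace (Ω m)]
    (P : ∀ m, Measure (Ω m)) [∀ m, IsProbabilityMeasure (P m)]
    -- sample size as a function of the number `m` of hypotheses, with `log m / n → d`
    (n : ℕ → ℕ) (hn : ∀ m, 2 ≤ n m)
    (d : ℝ) (hd : 0 ≤ d)
    (hA : Tendsto (fun m : ℕ => Real.log m / n m) atTop (𝓝 d))
    -- independent normal data with arbitrary means and common variance `σ²`
    (mean : ∀ m, Fin m → ℝ) (σ : ℝ≥0) (hσ : 0 < σ)
    (X : ∀ m, Fin m → Fin (n m) → Ω m → ℝ)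
    (hX : ∀ m i j, HasLaw (X m i j) (gaussianReal (mean m i) (σ ^ 2)) (P m))
    (hindep : ∀ m, iIndepFun (fun p : Fin m × Fin (n m) => X m p.1 p.2) (P m))
    -- the variance estimator
    (σ2hat : ∀ m, Ω m → ℝ) (hmeas : ∀ m, AEMeasurable (σ2hat m) (P m))
    (hσ2hat : TwoStage.IsBigOP P (fun m ω => σ2hat m ω - (σ : ℝ) ^ 2)
      (fun m => 1 / √((m : ℝ) * n m)))
    (α : ℝ) (hα0 : 0 < α) (hα1 : α < 1)
    (γ : ℝ) (hγ0 : 0 < γ) (hγ1 : γ ≤ 1) :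
    (1 / 2 < γ →
      limsup (fun m => TwoStage.fwer (P m) α γ (mean m) (X m) (σ2hat m)) atTop
        ≤ ENNReal.ofReal α) ∧
    (γ = 1 / 2 → 0 < d →
      limsup (fun m => TwoStage.fwer (P m) α γ (mean m) (X m) (σ2hat m)) atTop
        ≤ ENNReal.ofReal α) ∧
    (0 < d →
      1 / 2 * (1 - TwoStage.epsStar γ d / d + Real.log (1 + TwoStage.epsStar γ d) / d) < γ →
      limsup (fun m => TwoStage.fwer (P m) α γ (mean m) (X m) (σ2hat m)) atTop
        ≤ ENNReal.ofReal α) := by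
  have h := TwoStage.limsup_fwer_le hn hσ hX hindep hσ2hat hα0 hα1 hγ0 hγ1
  exact ⟨fun _ => h, fun _ _ => h, fun _ _ => h⟩
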